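/- Let $X$ be a complex manifold of dimension $4$ with holomorphic tangent bundle $T_X$. An \emph{Engel structure} on $X$ is a holomorphic vector subbundle $D\subset T_X$ of rank $2$ such that $\mathcal E=[D,D]$ (the subspaces of the tangent spaces spanned by $D$ and by the Lie brackets of local holomorphic sections of $D$) is an even contact structure, i.e. near every point $\mathcal E=\ker\theta$ for a nowhere vanishing holomorphic $1$-form $\theta$ such that $\theta\wedge d\theta$ is nowhere zero. On $\mathbb C^4$ with coordinates $(x,y,z,w)$ let $D_0$ be the field of planes given by $$dx-y\,dz=0,\qquad dy-w\,dz=0,$$ and let $D_0'$ be the field of planes given by $$dx-y\,dz=0,\qquad dy-w\,dx=0.$$ \textbf{Theorem (Darboux theorem for holomorphic Engel structures).} The field $D_0$ is an Engel structure on $\mathbb C^4$. Let $D$ be an Engel structure on $X$ and let $x_0\in X$. Then: 1. there are an open neighbourhood $U$ of $x_0$, an open set $V\subset\mathbb C^4$ and a biholomorphic map $\phi:V\to U$ such that $\phi^*D=D_0$ on $V$, that is, $\{v\in\mathbb C^4 : d\phi_p(v)\in D_{\phi(p)}\}=(D_0)_p$ for every $p\in V$; 2. there are also an open neighbourhood $U$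 of $x_0$, an open set $V\subset\{y\neq 0\}\subset\mathbb C^4$ and a biholomorphic map $\phi:V\to U$ such that $\phi^*D=D_0'$ on $V$. -/

import Mathlib

open scoped Manifold ContDiff

namespace HolEngel

/-- The complex coordinate space `ℂ⁴`; its coordinates `0, 1, 2, 3` are called `x, y, z, w`. -/
abbrev C4 : Type := Fin 4 → ℂ

section Manifold

variable {X : Type*} [TopologicalSpace X] [ChartedSpace C4 X]

/-- A field of complex linear subspaces of the (holomorphic) tangent spaces of `X`. -/
abbrev Distribution (X : Type*) [TopologicalSpace X] [ChartedSpace C4 X] : Type _ :=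
  (p : X) → Submodule ℂ (TangentSpace 𝓘(ℂ, C4) p)

/-- The vector field `V` is holomorphic on `U`. -/
def HolomorphicFieldOn [IsManifold 𝓘(ℂ, C4) ω X]
    (V : (p : X) → TangentSpace 𝓘(ℂ, C4) p) (U : Set X) : Prop :=
  ContMDiffOn 𝓘(ℂ, C4) (𝓘(ℂ, C4)).tangent ω
    (fun p => (⟨p, V p⟩ : TangentBundle 𝓘(ℂ, C4) X)) U

/-- `D` is a holomorphic vector subbundle of rank `k` of the tangent bundle of `X`:
near every point it has a frame of `k` holomorphic vector fields. -/
def IsHolomorphicSubbundle [IsManifold 𝓘(ℂ, C4) ω X] (k : ℕ) (D : Distribution X) : Prop :=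
  ∀ p : X, ∃ U : Set X, IsOpen U ∧ p ∈ U ∧
    ∃ V : Fin k → (q : X) → TangentSpace 𝓘(ℂ, C4) q,
      (∀ i, HolomorphicFieldOn (V i) U) ∧
      ∀ q ∈ U, LinearIndependent ℂ (fun i => V i q) ∧
        Submodule.span ℂ (Set.range fun i => V i q) = D q

/-- `V` is, near `p`, a holomorphic section of `D`. -/
def IsLocalSection [IsManifold 𝓘(ℂ, C4) ω X] (D : Distribution X) (p : X)
    (V : (q : X) → TangentSpace 𝓘(ℂ, C4) q) : Prop :=
  ∃ U : Set X, IsOpen U ∧ p ∈ U ∧ HolomorphicFieldOn V U ∧ ∀ q ∈ U, V q ∈ D q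

/-- `[D, D]`, fibre by fibre: the space spanned by `D p` and by the values at `p` of the Lie
brackets of local holomorphic sections of `D`. -/
noncomputable def bracket [IsManifold 𝓘(ℂ, C4) ω X] (D : Distribution X) : Distribution X := fun p =>
  D p ⊔ Submodule.span ℂ {u | ∃ V W : (q : X) → TangentSpace 𝓘(ℂ, C4) q,
    IsLocalSection D p V ∧ IsLocalSection D p W ∧
      u = VectorField.mlieBracket 𝓘(ℂ, C4) V W p}

/-- For a chart `e : U → V ⊆ ℂ⁴` with inverse `φ : V → U`, the pullback `φ^* D` on `V`:
its fibre at `p` consists of the `v` with `dφ_p v ∈ D (φ p)`. -/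
noncomputable def chartPullback (e : OpenPartialHomeomorph X C4) (D : Distribution X) (p : C4) :
    Submodule ℂ C4 :=
  (D (e.symm p)).comap (mfderiv 𝓘(ℂ, C4) 𝓘(ℂ, C4) e.symm p).toLinearMap

end Manifold

/-- The exterior derivative of a `1`-form on `ℂ⁴`:
`dθ_p (u, v) = (∂_u θ)(v) - (∂_v θ)(u)`. -/
noncomputable def extD (θ : C4 → (C4 →L[ℂ] ℂ)) (p : C4) (u v : C4) : ℂ :=
  fderiv ℂ θ p u v - fderiv ℂ θ p v u

/-- The `3`-form `θ ∧ dθ` at `p`, evaluated at three vectors. -/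
noncomputable def wedgeExtD (θ : C4 → (C4 →L[ℂ] ℂ)) (p : C4) (u v w : C4) : ℂ :=
  θ p u * extD θ p v w + θ p v * extD θ p w u + θ p w * extD θ p u v

/-- `extD` is Mathlib's exterior derivative. -/
theorem extD_eq_extDeriv (θ : C4 → (C4 →L[ℂ] ℂ)) (p u v : C4) (hθ : DifferentiableAt ℂ θ p) :
    extD θ p u v =
      extDeriv (fun q => ContinuousAlternatingMap.ofSubsingleton ℂ C4 ℂ (0 : Fin 1) (θ q)) p
        ![u, v] := by
  have h : DifferentiableAt ℂ
      (fun q => ContinuousAlternatingMap.ofSubsingleton ℂ C4 ℂ (0 : Fin 1) (θ q)) p :=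
    ((ContinuousAlternatingMap.ofSubsingletonLIE (𝕜 := ℂ) (E := C4) (F := ℂ)
      (0 : Fin 1)).toContinuousLinearEquiv.differentiableAt).comp p hθ
  have key (a b : C4) : fderiv ℂ (fun q => θ q a) p b = fderiv ℂ θ p b a := by
    have := hθ.hasFDerivAt.clm_apply (hasFDerivAt_const a p)
    rw [this.fderiv]
    simp
  rw [extDeriv_apply h]
  simp [extD, Fin.sum_univ_two, key, sub_eq_add_neg, Fin.removeNth]

/-- `E` is an even contact structure on the complex `4`-manifold `X`: near every point, in a
holomorphic chart, it is the kernel of a nowhere zero holomorphic `1`-form `θ` such that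
`θ ∧ dθ` is nowhere zero. -/
def IsEvenContact {X : Type*} [TopologicalSpace X] [ChartedSpace C4 X] (E : Distribution X) :
    Prop :=
  ∀ x : X, ∃ e ∈ IsManifold.maximalAtlas 𝓘(ℂ, C4) ω X, x ∈ e.source ∧
    ∃ θ : C4 → (C4 →L[ℂ] ℂ), AnalyticOnNhd ℂ θ e.target ∧
      ∀ p ∈ e.target, θ p ≠ 0 ∧ chartPullback e E p = LinearMap.ker (θ p).toLinearMap ∧
        ∃ u v w : C4, wedgeExtD θ p u v w ≠ 0

/-- An Engel structure on a complex `4`-manifold: a holomorphic subbundle `D` of rank `2` of the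
tangent bundle such that `[D, D]` is an even contact structure. -/
structure IsEngel {X : Type*} [TopologicalSpace X] [ChartedSpace C4 X]
    [IsManifold 𝓘(ℂ, C4) ω X] (D : Distribution X) : Prop where
  subbundle : IsHolomorphicSubbundle 2 D
  evenContact : IsEvenContact (bracket D)

/-- The coordinate covector `dx, dy, dz, dw` for `i = 0, 1, 2, 3`. -/
noncomputable def dc (i : Fin 4) : C4 →ₗ[ℂ] ℂ := LinearMap.proj i

/-- The standard model on `ℂ⁴`, cut out by `dx - y dz = 0` and `dy - w dz = 0`. -/
noncomputable def standardModel (p : C4) : Submodule ℂ C4 :=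
  LinearMap.ker (dc 0 - p 1 • dc 2) ⊓ LinearMap.ker (dc 1 - p 3 • dc 2)

/-- The field of planes on `ℂ⁴` cut out by `dx - y dz = 0` and `dy - w dx = 0`. It is an Engel
structure only on the open set where `y ≠ 0`: it is spanned by `∂_w` and
`∂_z + y ∂_x + w y ∂_y`, whose bracket is `y ∂_y`. -/
noncomputable def variantModel (p : C4) : Submodule ℂ C4 :=
  LinearMap.ker (dc 0 - p 1 • dc 2) ⊓ LinearMap.ker (dc 1 - p 3 • dc 0)

end HolEngel

/-!
The Darboux theorem for holomorphic Engel structures.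

The rank `3` field `E = [D, D] = ker θ` has a characteristic direction, the kernel of `dθ` on
`ker θ`. Since brackets of sections of `D` lie in `ker θ`, the form `dθ` vanishes on `D`; a plane on
which `dθ` vanishes contains the kernel of `dθ`, so the characteristic direction lies in `D`
(`exists_characteristicField`). Straightening it gives coordinates in which it is `∂_w`
(`exists_isAdaptedChart`).

The ratios of the coefficients of `θ` do not depend on `w`, so up to a factor `θ` is a contact form
`dx + r₁ dy + r₂ dz` in three variables. The field `∂_y - r₁ ∂_x` lies in its kernel. A first
integral `u` of this field gives `θ ∼ du - y' dz` (`exists_firstIntegral`,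
`exists_contactNormalForm`). As `∂_w ∈ D`, the plane `D` is cut out of `ker (du - y' dz)` by one
more equation `dy' - w' dz = 0`. The four functions `u, y', z, w'` are coordinates: the first three
are independent because `θ ∧ dθ ≠ 0`, and `w'` has nonzero derivative along `∂_w` because otherwise
`[D, D]` would lie in the kernel of `dy' - w' dz` (`exists_standardFunctions`,
`exists_standardChart`). The variant model is obtained by moving the point to `y = 1` by a symmetry
of the standard model and replacing `w` by `w / y` (`exists_variantChart`).

Both straightenings rest on the flow of a holomorphic vector field in complex time, jointly
holomorphic in time and initial value (`exists_analytic_flow`). It is obtained by applying the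
analytic inverse function theorem to the integral equation `g = x + t ∫ V(g)` in the Banach space of
continuous paths `[0, 1] → E`, where superposition with an analytic map is analytic
(`exists_analyticAt_superposition`).
-/

namespace HolEngel

open scoped Topology unitInterval
open Filter

/-! ### Holomorphic flows -/

section Flow

variable {E : Type*} [NormedAddCommGroup E] [NormedSpace ℂ E]

lemma _root_.ContinuousLinearMap.comp_analyticAt {F G : Type*} [NormedAddCommGroup F]
    [NormedSpace ℂ F] [NormedAddCommGroup G] [NormedSpace ℂ G] (L : F →L[ℂ] G) {f : E → F} {x : E}
    (hf : AnalyticAt ℂ f x) : AnalyticAt ℂ (fun y => L (f y)) x :=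
  AnalyticAt.comp (g := fun z => L z) (L.analyticAt (f x)) hf

/-- A continuous multilinear map, applied pointwise to continuous paths. -/
noncomputable def pathMultilinear {n : ℕ} (m : ContinuousMultilinearMap ℂ (fun _ : Fin n => E) E) :
    ContinuousMultilinearMap ℂ (fun _ : Fin n => C(I, E)) C(I, E) :=
  MultilinearMap.mkContinuous
    { toFun := fun g => ⟨fun s => m fun i => g i s, by fun_prop⟩
      map_update_add' := by
        intro _ g i x y
        ext s
        have h (z : C(I, E)) : (fun j => (Function.update g i z) j s)
            = Function.update (fun j => g j s) i (z s) := by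
          ext j; by_cases hj : j = i
          · subst hj; simp
          · simp [hj]
        simp [h]
      map_update_smul' := by
        intro _ g i c x
        ext s
        have h (z : C(I, E)) : (fun j => (Function.update g i z) j s)
            = Function.update (fun j => g j s) i (z s) := by
          ext j; by_cases hj : j = i
          · subst hj; simp
          · simp [hj]
        simp [h] } ‖m‖ (by
      intro g
      refine (ContinuousMap.norm_le _ (by positivity)).2 fun s => ?_
      refine (m.le_opNorm _).trans ?_
      gcongr with i
      exact (g i).norm_coe_le_norm s)

lemma norm_pathMultilinear_le {n : ℕ} (m : ContinuousMultilinearMap ℂ (fun _ : Fin n => E) E) :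
    ‖pathMultilinear m‖ ≤ ‖m‖ :=
  MultilinearMap.mkContinuous_norm_le _ (norm_nonneg _) _

/-- Superposition `g ↦ V ∘ g` with an analytic `V` is analytic on continuous paths. -/
lemma exists_analyticAt_superposition [CompleteSpace E] {V : E → E} {p : E}
    (hV : AnalyticAt ℂ V p) :
    ∃ N : C(I, E) → C(I, E), AnalyticAt ℂ N (ContinuousMap.const I p) ∧
      ∀ᶠ g in 𝓝 (ContinuousMap.const I p), ∀ s, N g s = V (g s) := by
  obtain ⟨q, r, hq⟩ := hV
  let Q : FormalMultilinearSeries ℂ C(I, E) C(I, E) := fun n => pathMultilinear (q n)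
  have hQ : r ≤ Q.radius := by
    refine hq.r_le.trans (FormalMultilinearSeries.radius_le_of_le (p := Q) (q := q) ?_)
    exact fun n => norm_pathMultilinear_le (q n)
  have hpos : 0 < Q.radius := hq.r_pos.trans_le hQ
  have hQs := Q.hasFPowerSeriesOnBall hpos
  refine ⟨fun g => Q.sum (g - ContinuousMap.const I p), ?_, ?_⟩
  · have := hQs.comp_sub (ContinuousMap.const I p)
    rw [zero_add] at this
    exact this.analyticAt
  · filter_upwards [Metric.eball_mem_nhds _ hq.r_pos] with g hg s
    have hg' : g - ContinuousMap.const I p ∈ Metric.eball (0 : C(I, E)) Q.radius := by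
      rw [Metric.mem_eball, edist_zero_right, ← edist_eq_enorm_sub]
      exact lt_of_lt_of_le (by simpa using hg) hQ
    have h1 := hQs.hasSum hg'
    rw [zero_add] at h1
    have h2 := h1.mapL (ContinuousMap.evalCLM ℂ s)
    have h3 : g s - p ∈ Metric.eball (0 : E) r := by
      rw [Metric.mem_eball, edist_zero_right, ← edist_eq_enorm_sub]
      refine lt_of_le_of_lt ?_ (show edist g (ContinuousMap.const I p) < r from hg)
      rw [edist_dist, edist_dist]
      exact ENNReal.ofReal_le_ofReal
        (ContinuousMap.dist_apply_le_dist (f := g) (g := ContinuousMap.const I p) s)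
    have h4 := hq.hasSum h3
    rw [add_sub_cancel] at h4
    exact h2.unique h4

/-- Integration from `0`, as an operator on continuous paths. -/
noncomputable def pathIntegral [CompleteSpace E] : C(I, E) →L[ℂ] C(I, E) :=
  LinearMap.mkContinuous
    { toFun := fun g => ⟨fun s => ∫ r in (0 : ℝ)..s, g (Set.projIcc 0 1 zero_le_one r), by
        have hc : Continuous fun r : ℝ => g (Set.projIcc 0 1 zero_le_one r) := by fun_prop
        exact (intervalIntegral.continuous_primitive
          (fun a b => hc.intervalIntegrable a b) 0).comp continuous_subtype_val⟩
      map_add' := by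
        intro g h
        ext s
        have hc (k : C(I, E)) : Continuous fun r : ℝ => k (Set.projIcc 0 1 zero_le_one r) := by
          fun_prop
        exact intervalIntegral.integral_add ((hc g).intervalIntegrable _ _)
          ((hc h).intervalIntegrable _ _)
      map_smul' := by
        intro c g
        ext s
        exact intervalIntegral.integral_smul c _ } 1 (by
      intro g
      refine (ContinuousMap.norm_le _ (by positivity)).2 fun s => ?_
      refine (intervalIntegral.norm_integral_le_of_norm_le_const
        fun r _ => g.norm_coe_le_norm _).trans ?_
      rw [one_mul, sub_zero, abs_of_nonneg s.2.1]
      exact mul_le_of_le_one_right (norm_nonneg _) s.2.2)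

lemma pathIntegral_apply [CompleteSpace E] (g : C(I, E)) (s : I) :
    pathIntegral g s = ∫ r in (0 : ℝ)..s, g (Set.projIcc 0 1 zero_le_one r) := rfl

/-- Reparametrization of paths by `s ↦ a s`, for `a` in the unit interval. -/
def pathScale (a : I) (g : C(I, E)) : C(I, E) := ⟨fun s => g (a * s), by fun_prop⟩

lemma smul_pathIntegral_pathScale [CompleteSpace E] (a : I) (g : C(I, E)) (s : I) :
    ((a : ℝ) : ℂ) • pathIntegral (pathScale a g) s = pathIntegral g (a * s) := by
  have h := intervalIntegral.smul_integral_comp_mul_left (a := (0 : ℝ)) (b := s)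
    (fun r => g (Set.projIcc 0 1 zero_le_one r)) (a : ℝ)
  rw [pathIntegral_apply, pathIntegral_apply, Complex.coe_smul, Set.Icc.coe_mul]
  rw [mul_zero] at h
  rw [← h]
  congr 1
  refine intervalIntegral.integral_congr fun r hr => ?_
  rw [Set.uIcc_of_le s.2.1] at hr
  have hr1 : r ∈ Set.Icc (0 : ℝ) 1 := ⟨hr.1, hr.2.trans s.2.2⟩
  have har : (a : ℝ) * r ∈ Set.Icc (0 : ℝ) 1 :=
    ⟨mul_nonneg a.2.1 hr1.1, mul_le_one₀ a.2.2 hr1.1 hr1.2⟩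
  simp only [pathScale, ContinuousMap.coe_mk]
  rw [Set.projIcc_of_mem zero_le_one hr1, Set.projIcc_of_mem zero_le_one har]
  rfl

lemma hasDerivAt_pathIntegral [CompleteSpace E] (g : C(I, E)) (s : ℝ) :
    HasDerivAt (fun b : ℝ => ∫ r in (0 : ℝ)..b, g (Set.projIcc 0 1 zero_le_one r))
      (g (Set.projIcc 0 1 zero_le_one s)) s := by
  have hc : Continuous fun r : ℝ => g (Set.projIcc 0 1 zero_le_one r) := by fun_prop
  exact (hc.integral_hasStrictDerivAt 0 s).hasDerivAt

/-- The solution `g : [0, 1] → E` of `g = x + t ∫ V(g)` is an analytic function of `(t, x)`, by the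
inverse function theorem in the Banach space of continuous paths. Its local uniqueness gives the
compatibility with rescaling of time, `G (a t, x) = G (t, x) (a ·)`. -/
lemma exists_analytic_pathSolution [CompleteSpace E] {V : E → E} {p : E}
    (hV : AnalyticAt ℂ V p) :
    ∃ G : ℂ × E → C(I, E), AnalyticAt ℂ G (0, p) ∧ G (0, p) = ContinuousMap.const I p ∧
      ∀ᶠ y in 𝓝 ((0, p) : ℂ × E),
        (∃ k : C(I, E), (∀ s, k s = V (G y s)) ∧
          G y = ContinuousMap.const I y.2 + y.1 • pathIntegral k) ∧
        ∀ a : I, G (((a : ℝ) : ℂ) * y.1, y.2) = pathScale a (G y) := by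
  obtain ⟨N, hN, hNV⟩ := exists_analyticAt_superposition hV
  set c : C(I, E) := ContinuousMap.const I p with hc
  let K : E →L[ℂ] C(I, E) := ContinuousLinearMap.const ℂ I
  have hK (x : E) : K x = ContinuousMap.const I x := rfl
  let Ψ : ℂ × E × C(I, E) → ℂ × E × C(I, E) :=
    fun z => (z.1, z.2.1, z.2.2 - K z.2.1 - z.1 • pathIntegral (N z.2.2))
  have hN' : AnalyticAt ℂ (fun z : ℂ × E × C(I, E) => N z.2.2) (0, p, c) :=
    AnalyticAt.comp (g := N) (f := fun z : ℂ × E × C(I, E) => z.2.2) hN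
      (analyticAt_snd.comp analyticAt_snd)
  have hJN : AnalyticAt ℂ (fun z : ℂ × E × C(I, E) => pathIntegral (N z.2.2)) (0, p, c) :=
    (pathIntegral (E := E)).comp_analyticAt hN'
  have hΨ : AnalyticAt ℂ Ψ (0, p, c) := by
    refine analyticAt_fst.prod ((analyticAt_fst.comp analyticAt_snd).prod ?_)
    refine ((analyticAt_snd.comp analyticAt_snd).sub
      ((K.analyticAt _).comp (analyticAt_fst.comp analyticAt_snd))).sub ?_
    exact analyticAt_fst.smul hJN
  let b : C(I, E) := pathIntegral (N c)
  let Λ : (ℂ × E × C(I, E)) ≃L[ℂ] (ℂ × E × C(I, E)) :=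
    ContinuousLinearEquiv.equivOfInverse
      ((ContinuousLinearMap.fst ℂ ℂ (E × C(I, E))).prod
        (((ContinuousLinearMap.fst ℂ E C(I, E)).comp (ContinuousLinearMap.snd ℂ ℂ _)).prod
          ((ContinuousLinearMap.snd ℂ E C(I, E)).comp (ContinuousLinearMap.snd ℂ ℂ _)
            - K.comp ((ContinuousLinearMap.fst ℂ E C(I, E)).comp (ContinuousLinearMap.snd ℂ ℂ _))
            - (ContinuousLinearMap.fst ℂ ℂ (E × C(I, E))).smulRight b)))
      ((ContinuousLinearMap.fst ℂ ℂ (E × C(I, E))).prod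
        (((ContinuousLinearMap.fst ℂ E C(I, E)).comp (ContinuousLinearMap.snd ℂ ℂ _)).prod
          ((ContinuousLinearMap.snd ℂ E C(I, E)).comp (ContinuousLinearMap.snd ℂ ℂ _)
            + K.comp ((ContinuousLinearMap.fst ℂ E C(I, E)).comp (ContinuousLinearMap.snd ℂ ℂ _))
            + (ContinuousLinearMap.fst ℂ ℂ (E × C(I, E))).smulRight b)))
      (by rintro ⟨t, x, g⟩; ext <;> (simp; try abel))
      (by rintro ⟨t, x, g⟩; ext <;> (simp; try abel))
  -- at `t = 0` the derivative of `Ψ` is a shear, hence invertible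
  have hΛ : HasFDerivAt Ψ (Λ : (ℂ × E × C(I, E)) →L[ℂ] (ℂ × E × C(I, E))) (0, p, c) := by
    refine HasFDerivAt.prodMk hasFDerivAt_fst (HasFDerivAt.prodMk
      (hasFDerivAt_fst.comp _ hasFDerivAt_snd) ?_)
    have h1 := (hasFDerivAt_fst (𝕜 := ℂ) (p := ((0, p, c) : ℂ × E × C(I, E)))).smul
      hJN.differentiableAt.hasFDerivAt
    refine ((((hasFDerivAt_snd.comp _ hasFDerivAt_snd)).sub
      (K.hasFDerivAt.comp _ (hasFDerivAt_fst.comp _ hasFDerivAt_snd))).sub h1).congr_fderiv ?_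
    simp [b]
  have hΨ' : ContDiffAt ℂ ω Ψ (0, p, c) := hΨ.contDiffAt
  let Θ := hΨ'.toOpenPartialHomeomorph Ψ hΛ (by simp)
  have hmem : ((0, p, c) : ℂ × E × C(I, E)) ∈ Θ.source :=
    hΨ'.mem_toOpenPartialHomeomorph_source hΛ (by simp)
  have hΨ0 : Ψ (0, p, c) = (0, p, 0) := by simp [Ψ, hK, hc]
  have htgt : ((0, p, 0) : ℂ × E × C(I, E)) ∈ Θ.target := by
    have := Θ.map_source hmem
    rwa [show Θ (0, p, c) = (0, p, 0) from hΨ0] at this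
  have hsymm0 : Θ.symm (0, p, 0) = (0, p, c) := by
    rw [← hΨ0]; exact Θ.left_inv hmem
  have hinv : AnalyticAt ℂ Θ.symm (0, p, 0) := by
    have h := hΨ'.to_localInverse hΛ (by simp)
    rw [hΨ0] at h
    exact h.analyticAt
  let G : ℂ × E → C(I, E) := fun y => (Θ.symm (y.1, y.2, 0)).2.2
  have hι : AnalyticAt ℂ (fun y : ℂ × E => ((y.1, y.2, 0) : ℂ × E × C(I, E))) (0, p) :=
    analyticAt_fst.prod (analyticAt_snd.prod analyticAt_const)
  have hG : AnalyticAt ℂ G (0, p) := by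
    have h1 : AnalyticAt ℂ (fun y : ℂ × E => Θ.symm (y.1, y.2, 0)) (0, p) :=
      AnalyticAt.comp (g := Θ.symm) hinv hι
    exact (analyticAt_snd.comp analyticAt_snd).comp h1
  have hG0 : G (0, p) = c := by simp only [G]; rw [hsymm0]
  have hsrc : ∀ᶠ z in 𝓝 ((0, p, c) : ℂ × E × C(I, E)),
      z ∈ Θ.source ∧ ∀ s, N z.2.2 s = V (z.2.2 s) := by
    refine Filter.Eventually.and (Θ.open_source.mem_nhds hmem) ?_
    have : Tendsto (fun z : ℂ × E × C(I, E) => z.2.2) (𝓝 (0, p, c)) (𝓝 c) :=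
      (continuous_snd.comp continuous_snd).tendsto _
    exact this.eventually hNV
  obtain ⟨ε, hε, hball⟩ := Metric.eventually_nhds_iff.1 hsrc
  have hev : ∀ᶠ y in 𝓝 ((0, p) : ℂ × E), dist y (0, p) < ε ∧ dist (G y) c < ε ∧
      ((y.1, y.2, 0) : ℂ × E × C(I, E)) ∈ Θ.target := by
    refine Filter.Eventually.and (Metric.ball_mem_nhds _ hε) (Filter.Eventually.and ?_ ?_)
    · have := hG.continuousAt
      rw [ContinuousAt, hG0] at this
      exact this.eventually (Metric.ball_mem_nhds _ hε)
    · exact hι.continuousAt.eventually (Θ.open_target.mem_nhds htgt)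
  obtain ⟨δ, hδ, hδball⟩ := Metric.eventually_nhds_iff.1 hev
  have hsol : ∀ y, dist y ((0, p) : ℂ × E) < δ →
      G y = ContinuousMap.const I y.2 + y.1 • pathIntegral (N (G y)) := by
    intro y hy
    have h1 := Θ.right_inv (hδball hy).2.2
    change Ψ (Θ.symm (y.1, y.2, 0)) = _ at h1
    simp only [Ψ, Prod.mk.injEq] at h1
    obtain ⟨h2, h3, h4⟩ := h1
    rw [h2, h3, hK] at h4
    rw [sub_sub, sub_eq_zero] at h4
    exact h4
  refine ⟨G, hG, hG0, ?_⟩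
  filter_upwards [Metric.ball_mem_nhds _ hδ] with y hy
  have hy' : dist y ((0, p) : ℂ × E) < δ := hy
  have hin (y : ℂ × E) (g : C(I, E)) (h1 : dist y (0, p) < ε) (h2 : dist g c < ε) :
      dist ((y.1, y.2, g) : ℂ × E × C(I, E)) (0, p, c) < ε := by
    rw [Prod.dist_eq, max_lt_iff] at h1
    rw [Prod.dist_eq, Prod.dist_eq, max_lt_iff, max_lt_iff]
    exact ⟨h1.1, h1.2, h2⟩
  have hNG : ∀ s, N (G y) s = V (G y s) :=
    (hball (hin y (G y) (hδball hy').1 (hδball hy').2.1)).2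
  refine ⟨⟨N (G y), hNG, hsol y hy'⟩, fun a => ?_⟩
  set y' : ℂ × E := (((a : ℝ) : ℂ) * y.1, y.2) with hy'def
  have hyd : dist y' ((0, p) : ℂ × E) < δ := by
    rw [Prod.dist_eq, max_lt_iff] at hy' ⊢
    refine ⟨lt_of_le_of_lt ?_ hy'.1, hy'.2⟩
    simp only [hy'def, dist_zero_right, norm_mul, Complex.norm_real, Real.norm_eq_abs]
    rw [abs_of_nonneg a.2.1]
    exact mul_le_of_le_one_left (norm_nonneg _) a.2.2
  have hscale : dist (pathScale a (G y)) c < ε := by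
    refine (ContinuousMap.dist_lt_iff hε).2 fun s => ?_
    exact lt_of_le_of_lt (ContinuousMap.dist_apply_le_dist (f := G y) (g := c) (a * s))
      (hδball hy').2.1
  have hm1 := hball (hin y' (G y') (hδball hyd).1 (hδball hyd).2.1)
  have hm2 := hball (hin y' (pathScale a (G y)) (hδball hyd).1 hscale)
  have hNs : N (pathScale a (G y)) = pathScale a (N (G y)) := by
    ext s
    rw [hm2.2 s]
    exact (hNG (a * s)).symm
  have hsol2 : pathScale a (G y) = ContinuousMap.const I y'.2
      + y'.1 • pathIntegral (N (pathScale a (G y))) := by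
    ext s
    have h1 := congrArg (fun g : C(I, E) => g (a * s)) (hsol y hy')
    simp only [ContinuousMap.add_apply, ContinuousMap.const_apply, ContinuousMap.smul_apply] at h1 ⊢
    rw [← smul_pathIntegral_pathScale] at h1
    change G y (a * s) = _
    rw [h1, hNs, smul_smul, mul_comm y.1]
  -- both paths solve the equation with time `a t`, so they agree by injectivity of `Ψ`
  have heq : Ψ (y'.1, y'.2, G y') = Ψ (y'.1, y'.2, pathScale a (G y)) := by
    simp only [Ψ, hK, Prod.mk.injEq, true_and]
    rw [sub_sub, sub_sub, sub_eq_zero.2 (hsol y' hyd), sub_eq_zero.2 hsol2]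
  have := Θ.injOn hm1.1 hm2.1 heq
  simpa using congrArg (fun z : ℂ × E × C(I, E) => z.2.2) this

/-- The local flow of an analytic vector field in complex time, jointly analytic in time and initial
value: the time-one value of the solution of `g' = t V(g)`, `g(0) = x`. -/
theorem exists_analytic_flow [CompleteSpace E] {V : E → E} {p : E} (hV : AnalyticAt ℂ V p) :
    ∃ φ : ℂ × E → E, AnalyticAt ℂ φ (0, p) ∧ (∀ᶠ x in 𝓝 p, φ (0, x) = x) ∧
      ∀ᶠ y in 𝓝 ((0, p) : ℂ × E), HasDerivAt (fun t => φ (t, y.2)) (V (φ y)) y.1 := by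
  obtain ⟨G, hG, hG0, hsol⟩ := exists_analytic_pathSolution hV
  let φ : ℂ × E → E := fun y => G y 1
  have hφ : AnalyticAt ℂ φ (0, p) :=
    (ContinuousMap.evalCLM ℂ (1 : I) : C(I, E) →L[ℂ] E).comp_analyticAt hG
  have h0 : ∀ᶠ x in 𝓝 p, φ (0, x) = x := by
    have ht : Tendsto (fun x : E => ((0, x) : ℂ × E)) (𝓝 p) (𝓝 (0, p)) :=
      (by fun_prop : Continuous fun x : E => ((0, x) : ℂ × E)).tendsto _
    filter_upwards [ht.eventually hsol] with x hx
    obtain ⟨⟨k, -, hk⟩, -⟩ := hx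
    simp only [φ]
    rw [hk]
    simp
  refine ⟨φ, hφ, h0, ?_⟩
  obtain ⟨δ, hδ, hgood⟩ := Metric.eventually_nhds_iff.1 (hsol.and hφ.eventually_analyticAt)
  filter_upwards [Metric.ball_mem_nhds _ hδ] with y hy
  have hy' : dist y ((0, p) : ℂ × E) < δ := hy
  -- Write the time as `a T` with `T ≠ 0` and `a` in the unit interval, so as to differentiate
  -- the integral equation with respect to the real variable `a`.
  obtain ⟨T, a, hT0, haT, hTd⟩ : ∃ (T : ℂ) (a : I), T ≠ 0 ∧ ((a : ℝ) : ℂ) * T = y.1 ∧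
      dist ((T, y.2) : ℂ × E) (0, p) < δ := by
    by_cases ht : y.1 = 0
    · refine ⟨((δ / 2 : ℝ) : ℂ), 0, by simpa using hδ.ne', by simp [ht], ?_⟩
      rw [Prod.dist_eq, max_lt_iff] at hy' ⊢
      refine ⟨?_, hy'.2⟩
      rw [dist_zero_right, Complex.norm_real, Real.norm_eq_abs, abs_of_pos (by positivity)]
      linarith
    · exact ⟨y.1, 1, ht, by simp, hy'⟩
  obtain ⟨⟨⟨k, hkV, hk⟩, hscale⟩, -⟩ := hgood hTd
  have hφs (s : I) : φ (((s : ℝ) : ℂ) * T, y.2) = G (T, y.2) s := by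
    simp only [φ]
    rw [hscale s]
    simp [pathScale]
  have hφan : AnalyticAt ℂ φ y := (hgood hy').2
  have hd : HasDerivAt (fun t => φ (t, y.2)) (deriv (fun t => φ (t, y.2)) y.1) y.1 := by
    refine DifferentiableAt.hasDerivAt ?_
    exact DifferentiableAt.comp (g := φ) (f := fun t : ℂ => (t, y.2)) y.1
      hφan.differentiableAt (by fun_prop)
  have hyT : V (φ y) = k a := by
    rw [hkV, ← hφs, haT]
  -- the derivative in `a` by the chain rule
  have hd1 : HasDerivWithinAt (fun s : ℝ => φ ((s : ℂ) * T, y.2))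
      (T • deriv (fun t => φ (t, y.2)) y.1) (Set.Icc 0 1) a := by
    rw [← haT] at hd
    have hl : HasDerivAt (fun s : ℝ => (s : ℂ) * T) T a := by
      simpa using (Complex.ofRealCLM.hasDerivAt (x := (a : ℝ))).mul_const T
    rw [← haT]
    exact (hd.scomp (a : ℝ) hl).hasDerivWithinAt
  -- the same derivative from the integral equation
  have hd2 : HasDerivWithinAt (fun s : ℝ => φ ((s : ℂ) * T, y.2))
      (T • k a) (Set.Icc 0 1) a := by
    have h1 := ((hasDerivAt_pathIntegral k a).const_smul T).const_add y.2
    rw [Set.projIcc_val] at h1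
    refine h1.hasDerivWithinAt.congr_of_mem (fun s hs => ?_) a.2
    have h2 := hφs ⟨s, hs⟩
    rw [hk] at h2
    exact h2
  have := (uniqueDiffOn_Icc (zero_lt_one (α := ℝ)) a a.2).eq_deriv _ hd1 hd2
  rw [hyT, ← smul_right_injective E hT0 this]
  exact hd

end Flow

/-! ### Local coordinates and flow boxes -/

section LocalCoordinates

/-- A local homeomorphism of `ℂ⁴` which is holomorphic together with its inverse. -/
structure IsBianalytic (f : OpenPartialHomeomorph C4 C4) : Prop where
  analytic : AnalyticOnNhd ℂ f f.source
  analytic_symm : AnalyticOnNhd ℂ f.symm f.target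

lemma IsBianalytic.symm {f : OpenPartialHomeomorph C4 C4} (hf : IsBianalytic f) :
    IsBianalytic f.symm :=
  ⟨hf.analytic_symm, by simpa using hf.analytic⟩

/-- The holomorphic inverse function theorem, with a domain as small as desired. -/
lemma exists_isBianalytic {f : C4 → C4} {a : C4} (hf : AnalyticAt ℂ f a) (A : C4 ≃L[ℂ] C4)
    (hA : HasFDerivAt f (A : C4 →L[ℂ] C4) a) {s : Set C4} (hs : s ∈ 𝓝 a) :
    ∃ Φ : OpenPartialHomeomorph C4 C4, a ∈ Φ.source ∧ ⇑Φ = f ∧ Φ.source ⊆ s ∧ IsBianalytic Φ := by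
  have hf' : ContDiffAt ℂ ω f a := hf.contDiffAt
  let Θ := hf'.toOpenPartialHomeomorph f hA (by simp)
  have hmem : a ∈ Θ.source := hf'.mem_toOpenPartialHomeomorph_source hA (by simp)
  have hinv : AnalyticAt ℂ Θ.symm (Θ a) := (hf'.to_localInverse hA (by simp)).analyticAt
  have hgood : {x | x ∈ s ∧ AnalyticAt ℂ f x ∧ AnalyticAt ℂ Θ.symm (Θ x)} ∈ 𝓝 a := by
    refine Filter.inter_mem hs (Filter.inter_mem hf.eventually_analyticAt ?_)
    exact (Θ.continuousAt hmem).eventually hinv.eventually_analyticAt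
  refine ⟨Θ.restr {x | x ∈ s ∧ AnalyticAt ℂ f x ∧ AnalyticAt ℂ Θ.symm (Θ x)}, ?_, rfl, ?_, ?_, ?_⟩
  · rw [Θ.restr_source]
    exact ⟨hmem, mem_interior_iff_mem_nhds.2 hgood⟩
  · rw [Θ.restr_source]
    exact fun x hx => (interior_subset hx.2).1
  · intro x hx
    rw [Θ.restr_source] at hx
    exact (interior_subset hx.2).2.1
  · intro y hy
    have hx := (Θ.restr _).map_target hy
    rw [Θ.restr_source] at hx
    have h := (interior_subset hx.2).2.2
    have hy' : y ∈ Θ.target := hy.1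
    rwa [show Θ ((Θ.restr _).symm y) = y from Θ.right_inv hy'] at h

/-- Straightening of a holomorphic vector field `V` at a point `p` where it does not vanish: in
suitable coordinates `V` is the coordinate field `∂ᵢ`. The derivative `A` of the coordinate change
at the origin may be prescribed, subject to `A ∂ᵢ = V p`. -/
theorem exists_flowBox {V : C4 → C4} {p : C4} (hV : AnalyticAt ℂ V p) (A : C4 ≃L[ℂ] C4)
    (i : Fin 4) (hA : A (Pi.single i 1) = V p) {s : Set C4} (hs : s ∈ 𝓝 p) :
    ∃ Φ : OpenPartialHomeomorph C4 C4, (0 : C4) ∈ Φ.source ∧ Φ 0 = p ∧ IsBianalytic Φ ∧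
      Φ.target ⊆ s ∧ HasFDerivAt Φ (A : C4 →L[ℂ] C4) 0 ∧
      ∀ q ∈ Φ.source, fderiv ℂ Φ q (Pi.single i 1) = V (Φ q) := by
  obtain ⟨φ, hφ, hφ0, hφd⟩ := exists_analytic_flow hV
  let pr : C4 →L[ℂ] ℂ := ContinuousLinearMap.proj i
  let ε : C4 := Pi.single i 1
  have hprε : pr ε = 1 := by simp [pr, ε]
  -- `κ q` is the time `qᵢ` and the initial value obtained from the other coordinates of `q`.
  let Λ : C4 →L[ℂ] ℂ × C4 := pr.prod ((A : C4 →L[ℂ] C4).comp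
    (ContinuousLinearMap.id ℂ C4 - pr.smulRight ε))
  let κ : C4 → ℂ × C4 := fun q => (0, p) + Λ q
  have hκ (q : C4) : HasFDerivAt κ Λ q := Λ.hasFDerivAt.const_add _
  have hκa : AnalyticAt ℂ κ 0 := analyticAt_const.add (Λ.analyticAt 0)
  have hκ0 : κ 0 = (0, p) := by simp [κ]
  let f : C4 → C4 := fun q => φ (κ q)
  have hφ' : AnalyticAt ℂ φ (κ 0) := by rw [hκ0]; exact hφ
  have hfa : AnalyticAt ℂ f 0 := AnalyticAt.comp (g := φ) hφ' hκa
  have hf0 : f 0 = p := by simp only [f]; rw [hκ0]; exact hφ0.self_of_nhds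
  have hΛε : Λ ε = (1, 0) := by simp [Λ, hprε]
  have hgood : ∀ᶠ q in 𝓝 (0 : C4), f q ∈ s ∧ fderiv ℂ f q ε = V (f q) := by
    have hκt : Tendsto κ (𝓝 0) (𝓝 (0, p)) := by
      have := hκa.continuousAt; rwa [ContinuousAt, hκ0] at this
    have hft : Tendsto f (𝓝 0) (𝓝 p) := by
      have := hfa.continuousAt; rwa [ContinuousAt, hf0] at this
    filter_upwards [hft hs, hκt.eventually hφd, hκt.eventually hφ.eventually_analyticAt]
      with q hq hd ha
    refine ⟨hq, ?_⟩
    have h1 : HasFDerivAt f ((fderiv ℂ φ (κ q)).comp Λ) q :=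
      ha.differentiableAt.hasFDerivAt.comp q (hκ q)
    rw [h1.fderiv, ContinuousLinearMap.comp_apply, hΛε]
    have h2 : HasDerivAt (fun t => φ (t, (κ q).2)) (fderiv ℂ φ (κ q) (1, 0)) (κ q).1 := by
      have h3 : HasDerivAt (fun t : ℂ => ((t, (κ q).2) : ℂ × C4)) (1, 0) (κ q).1 :=
        (hasDerivAt_id _).prodMk (hasDerivAt_const _ _)
      exact ha.differentiableAt.hasFDerivAt.comp_hasDerivAt (κ q).1 h3
    exact h2.unique hd
  have hfA : HasFDerivAt f (A : C4 →L[ℂ] C4) 0 := by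
    have h1 : HasFDerivAt f ((fderiv ℂ φ (κ 0)).comp Λ) 0 :=
      hφ'.differentiableAt.hasFDerivAt.comp 0 (hκ 0)
    refine h1.congr_fderiv ?_
    ext1 v
    have h2 : fderiv ℂ φ (0, p) (1, 0) = V p := by
      have h3 : HasDerivAt (fun t : ℂ => ((t, p) : ℂ × C4)) (1, 0) 0 :=
        (hasDerivAt_id _).prodMk (hasDerivAt_const _ _)
      have h4 := hφ.differentiableAt.hasFDerivAt.comp_hasDerivAt (0 : ℂ) h3
      have h5 := hφd.self_of_nhds
      simp only [hφ0.self_of_nhds] at h5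
      exact h4.unique h5
    have h6 (x : C4) : fderiv ℂ φ (0, p) (0, x) = x := by
      have h7 : HasFDerivAt (fun x : C4 => ((0, x) : ℂ × C4)) (ContinuousLinearMap.inr ℂ ℂ C4) p :=
        (ContinuousLinearMap.inr ℂ ℂ C4).hasFDerivAt
      have h8 := hφ.differentiableAt.hasFDerivAt.comp p h7
      have h9 : HasFDerivAt (φ ∘ fun x : C4 => ((0, x) : ℂ × C4)) (ContinuousLinearMap.id ℂ C4) p :=
        (hasFDerivAt_id p).congr_of_eventuallyEq hφ0
      exact congrArg (fun L : C4 →L[ℂ] C4 => L x) (h8.unique h9)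
    have h10 : Λ v = pr v • ((1, 0) : ℂ × C4) + ((0, A (v - pr v • ε)) : ℂ × C4) := by
      simp [Λ]
    rw [ContinuousLinearMap.comp_apply, hκ0, h10, map_add, map_smul, h2, h6, ← hA]
    simp [ε]
  obtain ⟨Φ, h0, hΦ, hsub, hbi⟩ := exists_isBianalytic hfa A hfA hgood
  refine ⟨Φ, h0, by rw [hΦ]; exact hf0, hbi, ?_, by rw [hΦ]; exact hfA, ?_⟩
  · intro y hy
    have := (hsub (Φ.map_target hy)).1
    rwa [← hΦ, Φ.right_inv hy] at this
  · intro q hq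
    rw [hΦ]
    exact (hsub hq).2

end LocalCoordinates

/-! ### Vector fields and Lie brackets in charts -/

section Charts

variable {X : Type*} [TopologicalSpace X] [ChartedSpace C4 X]

lemma IsBianalytic.mem_contDiffGroupoid {f : OpenPartialHomeomorph C4 C4} (hf : IsBianalytic f) :
    f ∈ contDiffGroupoid ω 𝓘(ℂ, C4) := by
  rw [contDiffGroupoid, mem_groupoid_of_pregroupoid]
  constructor
  · simpa [contDiffPregroupoid] using! hf.analytic.contDiffOn f.open_source.uniqueDiffOn
  · simpa [contDiffPregroupoid] using! hf.analytic_symm.contDiffOn f.open_target.uniqueDiffOn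

lemma trans_mem_maximalAtlas {e : OpenPartialHomeomorph X C4}
    (he : e ∈ IsManifold.maximalAtlas 𝓘(ℂ, C4) ω X) {f : OpenPartialHomeomorph C4 C4}
    (hf : IsBianalytic f) : e ≫ₕ f ∈ IsManifold.maximalAtlas 𝓘(ℂ, C4) ω X := by
  rw [IsManifold.mem_maximalAtlas_iff, mem_maximalAtlas_iff] at he ⊢
  intro e' he'
  obtain ⟨h1, h2⟩ := he e' he'
  constructor
  · rw [OpenPartialHomeomorph.trans_symm_eq_symm_trans_symm, OpenPartialHomeomorph.trans_assoc]
    exact (contDiffGroupoid ω 𝓘(ℂ, C4)).trans hf.symm.mem_contDiffGroupoid h1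
  · rw [← OpenPartialHomeomorph.trans_assoc]
    exact (contDiffGroupoid ω 𝓘(ℂ, C4)).trans h2 hf.mem_contDiffGroupoid

lemma isInvertible_mfderiv_symm [IsManifold 𝓘(ℂ, C4) ω X] {e : OpenPartialHomeomorph X C4}
    (he : e ∈ IsManifold.maximalAtlas 𝓘(ℂ, C4) ω X) {p : C4} (hp : p ∈ e.target) :
    (mfderiv 𝓘(ℂ, C4) 𝓘(ℂ, C4) e.symm p).IsInvertible := by
  have h : e.symm.MDifferentiable 𝓘(ℂ, C4) 𝓘(ℂ, C4) :=
    ⟨(contMDiffOn_symm_of_mem_maximalAtlas he).mdifferentiableOn (by simp),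
      by simpa using (contMDiffOn_of_mem_maximalAtlas he).mdifferentiableOn (by simp)⟩
  exact ⟨h.mfderiv hp, rfl⟩

lemma exists_linearEquiv_mfderiv_symm [IsManifold 𝓘(ℂ, C4) ω X] {e : OpenPartialHomeomorph X C4}
    (he : e ∈ IsManifold.maximalAtlas 𝓘(ℂ, C4) ω X) {p : C4} (hp : p ∈ e.target) :
    ∃ L : C4 ≃ₗ[ℂ] TangentSpace 𝓘(ℂ, C4) (e.symm p),
      (∀ v, mfderiv 𝓘(ℂ, C4) 𝓘(ℂ, C4) e.symm p v = L v) ∧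
      ∀ D : Distribution X, chartPullback e D p =
        (D (e.symm p)).map (L.symm : TangentSpace 𝓘(ℂ, C4) (e.symm p) →ₗ[ℂ] C4) := by
  obtain ⟨L, hL⟩ := isInvertible_mfderiv_symm he hp
  refine ⟨L.toLinearEquiv, fun v => by rw [← hL]; rfl, fun D => ?_⟩
  rw [chartPullback, ← hL]
  exact (Submodule.map_equiv_eq_comap_symm L.toLinearEquiv.symm (D (e.symm p))).symm

lemma chartPullback_trans [IsManifold 𝓘(ℂ, C4) ω X] {e : OpenPartialHomeomorph X C4}
    (he : e ∈ IsManifold.maximalAtlas 𝓘(ℂ, C4) ω X) {f : OpenPartialHomeomorph C4 C4}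
    (hf : IsBianalytic f) (D : Distribution X) {p : C4} (hp : p ∈ (e ≫ₕ f).target) :
    chartPullback (e ≫ₕ f) D p =
      (chartPullback e D (f.symm p)).comap (fderiv ℂ f.symm p).toLinearMap := by
  rw [OpenPartialHomeomorph.trans_target] at hp
  have hf1 : MDifferentiableAt 𝓘(ℂ, C4) 𝓘(ℂ, C4) f.symm p :=
    (hf.analytic_symm p hp.1).differentiableAt.mdifferentiableAt
  have he1 : MDifferentiableAt 𝓘(ℂ, C4) 𝓘(ℂ, C4) e.symm (f.symm p) :=
    (contMDiffAt_symm_of_mem_maximalAtlas he hp.2).mdifferentiableAt (by simp)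
  have h := mfderiv_comp p he1 hf1
  rw [mfderiv_eq_fderiv] at h
  ext v
  simp only [chartPullback, Submodule.mem_comap]
  have h2 : mfderiv 𝓘(ℂ, C4) 𝓘(ℂ, C4) (e ≫ₕ f).symm p v
      = mfderiv 𝓘(ℂ, C4) 𝓘(ℂ, C4) e.symm (f.symm p) (fderiv ℂ f.symm p v) :=
    congrArg (fun L : C4 →L[ℂ] TangentSpace 𝓘(ℂ, C4) (e.symm (f.symm p)) => L v) h
  exact (iff_of_eq (congrArg (fun w => w ∈ D (e.symm (f.symm p))) h2))

/-- The expression of the vector field `V` in the chart `e`. -/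
noncomputable def chartField (e : OpenPartialHomeomorph X C4)
    (V : (x : X) → TangentSpace 𝓘(ℂ, C4) x) (p : C4) : C4 :=
  VectorField.mpullback 𝓘(ℂ, C4) 𝓘(ℂ, C4) e.symm V p

lemma mfderiv_chartField [IsManifold 𝓘(ℂ, C4) ω X] {e : OpenPartialHomeomorph X C4}
    (he : e ∈ IsManifold.maximalAtlas 𝓘(ℂ, C4) ω X) {p : C4} (hp : p ∈ e.target)
    (V : (x : X) → TangentSpace 𝓘(ℂ, C4) x) :
    mfderiv 𝓘(ℂ, C4) 𝓘(ℂ, C4) e.symm p (chartField e V p) = V (e.symm p) := by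
  obtain ⟨L, hL⟩ := isInvertible_mfderiv_symm he hp
  simp only [chartField, VectorField.mpullback_apply]
  rw [← hL, ContinuousLinearMap.inverse_equiv]
  exact L.apply_symm_apply _

lemma chartField_mem_chartPullback [IsManifold 𝓘(ℂ, C4) ω X] {e : OpenPartialHomeomorph X C4}
    (he : e ∈ IsManifold.maximalAtlas 𝓘(ℂ, C4) ω X) {p : C4} (hp : p ∈ e.target)
    (V : (x : X) → TangentSpace 𝓘(ℂ, C4) x) (D : Distribution X) :
    chartField e V p ∈ chartPullback e D p ↔ V (e.symm p) ∈ D (e.symm p) := by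
  rw [← mfderiv_chartField he hp V]
  rfl

lemma analyticAt_chartField [IsManifold 𝓘(ℂ, C4) ω X] {e : OpenPartialHomeomorph X C4}
    (he : e ∈ IsManifold.maximalAtlas 𝓘(ℂ, C4) ω X) {p : C4} (hp : p ∈ e.target)
    {V : (x : X) → TangentSpace 𝓘(ℂ, C4) x} {U : Set X} (hU : IsOpen U) (hpU : e.symm p ∈ U)
    (hV : HolomorphicFieldOn V U) : AnalyticAt ℂ (chartField e V) p := by
  have : IsManifold 𝓘(ℂ, C4) 1 X := IsManifold.of_le (n := ω) le_top
  have h1 := ((hV _ hpU).contMDiffAt (hU.mem_nhds hpU))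
  have h2 := ContMDiffAt.mpullback_vectorField_preimage (m := ω) (n := ω) h1
    (contMDiffAt_symm_of_mem_maximalAtlas he hp) (isInvertible_mfderiv_symm he hp) (by simp)
  exact (contMDiffAt_vectorSpace_iff_contDiffAt.1 h2).analyticAt

lemma chartField_mlieBracket [IsManifold 𝓘(ℂ, C4) ω X] {e : OpenPartialHomeomorph X C4}
    (he : e ∈ IsManifold.maximalAtlas 𝓘(ℂ, C4) ω X) {p : C4} (hp : p ∈ e.target)
    {V W : (x : X) → TangentSpace 𝓘(ℂ, C4) x} {U : Set X} (hU : IsOpen U) (hpU : e.symm p ∈ U)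
    (hV : HolomorphicFieldOn V U) (hW : HolomorphicFieldOn W U) :
    chartField e (VectorField.mlieBracket 𝓘(ℂ, C4) V W) p =
      VectorField.lieBracket ℂ (chartField e V) (chartField e W) p := by
  have hm : IsManifold 𝓘(ℂ, C4) (minSmoothness ℂ 3) X := IsManifold.of_le (n := ω) le_top
  have h1 := ((hV _ hpU).contMDiffAt (hU.mem_nhds hpU)).mdifferentiableAt (by simp)
  have h2 := ((hW _ hpU).contMDiffAt (hU.mem_nhds hpU)).mdifferentiableAt (by simp)
  have h := VectorField.mpullback_mlieBracket (n := ω) h1 h2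
    (contMDiffAt_symm_of_mem_maximalAtlas he hp) le_top
  refine Eq.trans h ?_
  rw [← VectorField.mlieBracketWithin_univ, VectorField.mlieBracketWithin_eq_lieBracketWithin]
  exact congrFun (VectorField.lieBracketWithin_univ (𝕜 := ℂ) (V := chartField e V)
    (W := chartField e W)) p

/-- Cartan's formula for a `1`-form that annihilates both vector fields. -/
lemma apply_lieBracket {β : C4 → (C4 →L[ℂ] ℂ)} {V W : C4 → C4} {p : C4}
    (hβ : DifferentiableAt ℂ β p) (hV : DifferentiableAt ℂ V p) (hW : DifferentiableAt ℂ W p)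
    (hβV : ∀ᶠ q in 𝓝 p, β q (V q) = 0) (hβW : ∀ᶠ q in 𝓝 p, β q (W q) = 0) :
    β p (VectorField.lieBracket ℂ V W p) = -extD β p (V p) (W p) := by
  have key {Z : C4 → C4} (hZ : DifferentiableAt ℂ Z p) (h0 : ∀ᶠ q in 𝓝 p, β q (Z q) = 0)
      (u : C4) : fderiv ℂ β p u (Z p) + β p (fderiv ℂ Z p u) = 0 := by
    have h1 := hβ.hasFDerivAt.clm_apply hZ.hasFDerivAt
    have h2 : HasFDerivAt (fun q => β q (Z q)) (0 : C4 →L[ℂ] ℂ) p :=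
      (hasFDerivAt_const (0 : ℂ) p).congr_of_eventuallyEq h0
    have h3 := congrArg (fun L : C4 →L[ℂ] ℂ => L u) (h1.unique h2)
    simp at h3
    linear_combination h3
  have h1 := key hV hβV (W p)
  have h2 := key hW hβW (V p)
  rw [VectorField.lieBracket_eq, extD, map_sub]
  linear_combination h2 - h1

lemma mlieBracket_mem_bracket [IsManifold 𝓘(ℂ, C4) ω X] {D : Distribution X} {x : X}
    {V W : (y : X) → TangentSpace 𝓘(ℂ, C4) y} (hV : IsLocalSection D x V)
    (hW : IsLocalSection D x W) : VectorField.mlieBracket 𝓘(ℂ, C4) V W x ∈ bracket D x :=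
  Submodule.mem_sup_right (Submodule.subset_span ⟨V, W, hV, hW, rfl⟩)

lemma exists_isLocalSection [IsManifold 𝓘(ℂ, C4) ω X] {k : ℕ} {D : Distribution X}
    (hD : IsHolomorphicSubbundle k D) (x : X) {u : TangentSpace 𝓘(ℂ, C4) x} (hu : u ∈ D x) :
    ∃ V : (y : X) → TangentSpace 𝓘(ℂ, C4) y, IsLocalSection D x V ∧ V x = u := by
  obtain ⟨U, hU, hxU, F, hF, hspan⟩ := hD x
  rw [← (hspan x hxU).2, Submodule.mem_span_range_iff_exists_fun] at hu
  obtain ⟨c, rfl⟩ := hu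
  refine ⟨fun y => ∑ i, c i • F i y, ⟨U, hU, hxU, ?_, fun y hy => ?_⟩, rfl⟩
  · exact ContMDiffOn.sum_section fun i _ => (hF i).const_smul_section
  · rw [← (hspan y hy).2]
    exact Submodule.sum_mem _ fun i _ =>
      Submodule.smul_mem _ _ (Submodule.subset_span ⟨i, rfl⟩)

/-- In a chart, a holomorphic subbundle has a holomorphic frame near every point. -/
lemma exists_chartFrame [IsManifold 𝓘(ℂ, C4) ω X] {k : ℕ} {D : Distribution X}
    (hD : IsHolomorphicSubbundle k D) {e : OpenPartialHomeomorph X C4}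
    (he : e ∈ IsManifold.maximalAtlas 𝓘(ℂ, C4) ω X) {p : C4} (hp : p ∈ e.target) :
    ∃ V : Fin k → C4 → C4, (∀ i, AnalyticAt ℂ (V i) p) ∧ ∀ᶠ q in 𝓝 p,
      LinearIndependent ℂ (fun i => V i q) ∧
        Submodule.span ℂ (Set.range fun i => V i q) = chartPullback e D q := by
  obtain ⟨U, hU, hxU, F, hF, hspan⟩ := hD (e.symm p)
  refine ⟨fun i => chartField e (F i), fun i => analyticAt_chartField he hp hU hxU (hF i), ?_⟩
  filter_upwards [e.open_target.mem_nhds hp,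
    (e.continuousAt_symm hp).eventually (hU.mem_nhds hxU)] with q hq hqU
  obtain ⟨L, hL, hLD⟩ := exists_linearEquiv_mfderiv_symm he hq
  have hF' (i : Fin k) : chartField e (F i) q = L.symm (F i (e.symm q)) := by
    rw [LinearEquiv.eq_symm_apply]
    exact (hL _).symm.trans (mfderiv_chartField he hq (F i))
  obtain ⟨h1, h2⟩ := hspan _ hqU
  simp only [hF']
  constructor
  · exact h1.map' (L.symm : TangentSpace 𝓘(ℂ, C4) (e.symm q) →ₗ[ℂ] C4)
      (LinearMap.ker_eq_bot.2 L.symm.injective)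
  · rw [hLD, ← h2, Submodule.map_span, ← Set.range_comp]
    rfl

/-- If a `1`-form annihilates `D` and its exterior derivative vanishes on `D` at `p`, then the form
annihilates `[D, D]` at `p`. -/
lemma chartPullback_bracket_le [IsManifold 𝓘(ℂ, C4) ω X] {D : Distribution X}
    {e : OpenPartialHomeomorph X C4} (he : e ∈ IsManifold.maximalAtlas 𝓘(ℂ, C4) ω X) {p : C4}
    (hp : p ∈ e.target) {β : C4 → (C4 →L[ℂ] ℂ)} (hβ : DifferentiableAt ℂ β p)
    (hβD : ∀ᶠ q in 𝓝 p, chartPullback e D q ≤ LinearMap.ker (β q).toLinearMap)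
    (hd : ∀ u ∈ chartPullback e D p, ∀ v ∈ chartPullback e D p, extD β p u v = 0) :
    chartPullback e (bracket D) p ≤ LinearMap.ker (β p).toLinearMap := by
  obtain ⟨L, hL, hLD⟩ := exists_linearEquiv_mfderiv_symm he hp
  rw [hLD, Submodule.map_le_iff_le_comap]
  refine sup_le (fun w hw => ?_) (Submodule.span_le.2 ?_)
  · refine hβD.self_of_nhds ?_
    rw [hLD]
    exact Submodule.mem_map_of_mem hw
  · rintro _ ⟨V, W, ⟨U, hU, hpU, hV, hVD⟩, ⟨U', hU', hpU', hW, hWD⟩, rfl⟩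
    have hpUU : e.symm p ∈ U ∩ U' := ⟨hpU, hpU'⟩
    have hev (Z : (x : X) → TangentSpace 𝓘(ℂ, C4) x) (hZ : ∀ x ∈ U ∩ U', Z x ∈ D x) :
        ∀ᶠ q in 𝓝 p, chartField e Z q ∈ chartPullback e D q := by
      filter_upwards [e.open_target.mem_nhds hp,
        (e.continuousAt_symm hp).eventually ((hU.inter hU').mem_nhds hpUU)] with q hq hqU
      exact (chartField_mem_chartPullback he hq Z D).2 (hZ _ hqU)
    have hVe := hev V fun x hx => hVD x hx.1
    have hWe := hev W fun x hx => hWD x hx.2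
    have h1 := apply_lieBracket hβ
      (analyticAt_chartField he hp hU hpU hV).differentiableAt
      (analyticAt_chartField he hp hU' hpU' hW).differentiableAt
      ((hβD.and hVe).mono fun q hq => hq.1 hq.2) ((hβD.and hWe).mono fun q hq => hq.1 hq.2)
    rw [← chartField_mlieBracket he hp (hU.inter hU') hpUU (hV.mono Set.inter_subset_left)
      (hW.mono Set.inter_subset_right), hd _ hVe.self_of_nhds _ hWe.self_of_nhds, neg_zero] at h1
    have h3 : L.symm (VectorField.mlieBracket 𝓘(ℂ, C4) V W (e.symm p))
        = chartField e (VectorField.mlieBracket 𝓘(ℂ, C4) V W) p := by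
      rw [LinearEquiv.symm_apply_eq]
      exact ((hL _).symm.trans (mfderiv_chartField he hp _)).symm
    exact (congrArg (β p) h3).trans h1

/-- If a `1`-form annihilates `[D, D]`, then its exterior derivative vanishes on `D`. -/
lemma extD_eq_zero_of_bracket_le [IsManifold 𝓘(ℂ, C4) ω X] {k : ℕ} {D : Distribution X}
    (hD : IsHolomorphicSubbundle k D)
    {e : OpenPartialHomeomorph X C4} (he : e ∈ IsManifold.maximalAtlas 𝓘(ℂ, C4) ω X) {p : C4}
    (hp : p ∈ e.target) {β : C4 → (C4 →L[ℂ] ℂ)} (hβ : DifferentiableAt ℂ β p)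
    (hβD : ∀ᶠ q in 𝓝 p, chartPullback e (bracket D) q ≤ LinearMap.ker (β q).toLinearMap)
    {u v : C4} (hu : u ∈ chartPullback e D p) (hv : v ∈ chartPullback e D p) :
    extD β p u v = 0 := by
  have hinj : Function.Injective (mfderiv 𝓘(ℂ, C4) 𝓘(ℂ, C4) e.symm p) := by
    obtain ⟨L, hL⟩ := isInvertible_mfderiv_symm he hp
    rw [← hL]
    exact L.injective
  obtain ⟨V, ⟨U, hU, hpU, hV, hVD⟩, hVu⟩ := exists_isLocalSection hD (e.symm p) hu
  obtain ⟨W, ⟨U', hU', hpU', hW, hWD⟩, hWv⟩ := exists_isLocalSection hD (e.symm p) hv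
  have hVu' : chartField e V p = u := hinj ((mfderiv_chartField he hp V).trans hVu)
  have hWv' : chartField e W p = v := hinj ((mfderiv_chartField he hp W).trans hWv)
  have hpUU : e.symm p ∈ U ∩ U' := ⟨hpU, hpU'⟩
  have hev (Z : (x : X) → TangentSpace 𝓘(ℂ, C4) x) (hZ : ∀ x ∈ U ∩ U', Z x ∈ D x) :
      ∀ᶠ q in 𝓝 p, β q (chartField e Z q) = 0 := by
    filter_upwards [e.open_target.mem_nhds hp, hβD,
      (e.continuousAt_symm hp).eventually ((hU.inter hU').mem_nhds hpUU)] with q hq hqβ hqU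
    exact hqβ ((chartField_mem_chartPullback he hq Z (bracket D)).2
      (Submodule.mem_sup_left (hZ _ hqU)))
  have h1 := apply_lieBracket hβ
    (analyticAt_chartField he hp hU hpU hV).differentiableAt
    (analyticAt_chartField he hp hU' hpU' hW).differentiableAt
    (hev V fun x hx => hVD x hx.1) (hev W fun x hx => hWD x hx.2)
  rw [← chartField_mlieBracket he hp (hU.inter hU') hpUU (hV.mono Set.inter_subset_left)
    (hW.mono Set.inter_subset_right), hVu', hWv'] at h1
  have h2 : chartField e (VectorField.mlieBracket 𝓘(ℂ, C4) V W) p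
      ∈ chartPullback e (bracket D) p := by
    rw [chartField_mem_chartPullback he hp]
    exact mlieBracket_mem_bracket ⟨U, hU, hpU, hV, hVD⟩ ⟨U', hU', hpU', hW, hWD⟩
  have h3 : β p (chartField e (VectorField.mlieBracket 𝓘(ℂ, C4) V W) p) = 0 :=
    hβD.self_of_nhds h2
  rw [h3] at h1
  exact neg_eq_zero.1 h1.symm

end Charts

/-! ### One-forms and the characteristic direction -/

section Forms

lemma analyticAt_clm_apply {E F G : Type*} [NormedAddCommGroup E] [NormedSpace ℂ E]
    [CompleteSpace E] [NormedAddCommGroup F] [NormedSpace ℂ F] [CompleteSpace F]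
    [NormedAddCommGroup G] [NormedSpace ℂ G] [CompleteSpace G] {L : E → F →L[ℂ] G} {f : E → F}
    {x : E} (hL : AnalyticAt ℂ L x) (hf : AnalyticAt ℂ f x) :
    AnalyticAt ℂ (fun y => L y (f y)) x :=
  ((hL.contDiffAt (n := ω)).clm_apply hf.contDiffAt).analyticAt

lemma extD_congr {θ η : C4 → (C4 →L[ℂ] ℂ)} {p : C4} (h : θ =ᶠ[𝓝 p] η) (u v : C4) :
    extD θ p u v = extD η p u v := by
  rw [extD, extD, h.fderiv_eq]

lemma extD_add_left (θ : C4 → (C4 →L[ℂ] ℂ)) (p u u' v : C4) :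
    extD θ p (u + u') v = extD θ p u v + extD θ p u' v := by
  simp [extD]; ring

lemma extD_smul_left (θ : C4 → (C4 →L[ℂ] ℂ)) (p u v : C4) (c : ℂ) :
    extD θ p (c • u) v = c * extD θ p u v := by
  simp [extD]; ring

lemma extD_swap (θ : C4 → (C4 →L[ℂ] ℂ)) (p u v : C4) : extD θ p u v = -extD θ p v u := by
  simp [extD]

lemma extD_add_right (θ : C4 → (C4 →L[ℂ] ℂ)) (p u v v' : C4) :
    extD θ p u (v + v') = extD θ p u v + extD θ p u v' := by
  simp [extD]; ring

lemma extD_smul_right (θ : C4 → (C4 →L[ℂ] ℂ)) (p u v : C4) (c : ℂ) :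
    extD θ p u (c • v) = c * extD θ p u v := by
  simp [extD]; ring

/-- If `dθ` vanishes on `ker θ`, then `θ ∧ dθ = 0`. -/
lemma wedgeExtD_eq_zero {θ : C4 → (C4 →L[ℂ] ℂ)} {p c : C4} (hc : θ p c = 1)
    (h : ∀ u v, θ p u = 0 → θ p v = 0 → extD θ p u v = 0) (u v w : C4) :
    wedgeExtD θ p u v w = 0 := by
  have key (a b : C4) : extD θ p a b = θ p a * extD θ p c b - θ p b * extD θ p c a := by
    have h1 := h (a + (-θ p a) • c) (b + (-θ p b) • c) (by simp [hc]) (by simp [hc])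
    have h2 : extD θ p c c = 0 := by simp [extD]
    simp only [extD_add_left, extD_add_right, extD_smul_left, extD_smul_right, h2] at h1
    rw [extD_swap θ p a c] at h1
    linear_combination h1
  rw [wedgeExtD, key v w, key w u, key u v]
  ring

lemma extD_smul_of_ker {f : C4 → ℂ} {β : C4 → (C4 →L[ℂ] ℂ)} {p u v : C4}
    (hf : DifferentiableAt ℂ f p) (hβ : DifferentiableAt ℂ β p) (hu : β p u = 0)
    (hv : β p v = 0) : extD (fun q => f q • β q) p u v = f p * extD β p u v := by
  have h := (hf.hasFDerivAt.smul hβ.hasFDerivAt).fderiv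
  rw [extD, extD, show (fun q => f q • β q) = (f • β) from rfl, h]
  simp [hu, hv]
  ring

/-- `d (dg - h dz) = - dh ∧ dz`. -/
lemma extD_contactForm {g h : C4 → ℂ} {p : C4} (hg : AnalyticAt ℂ g p)
    (hh : AnalyticAt ℂ h p) (u v : C4) :
    extD (fun q => fderiv ℂ g q - h q • (ContinuousLinearMap.proj 2 : C4 →L[ℂ] ℂ)) p u v =
      fderiv ℂ h p v * u 2 - fderiv ℂ h p u * v 2 := by
  have h1 : HasFDerivAt (fun q => fderiv ℂ g q - h q • (ContinuousLinearMap.proj 2 : C4 →L[ℂ] ℂ))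
      (fderiv ℂ (fderiv ℂ g) p
        - (fderiv ℂ h p).smulRight (ContinuousLinearMap.proj 2 : C4 →L[ℂ] ℂ)) p :=
    hg.fderiv.differentiableAt.hasFDerivAt.sub
      (HasFDerivAt.smul_const (F := C4 →L[ℂ] ℂ) hh.differentiableAt.hasFDerivAt
        (ContinuousLinearMap.proj 2))
  have hsymm : IsSymmSndFDerivAt ℂ g p :=
    (hg.contDiffAt (n := ω)).isSymmSndFDerivAt (by simp)
  rw [extD, h1.fderiv]
  simp [hsymm u v]

/-- Naturality of the exterior derivative. -/
lemma extD_pullback {Φ : C4 → C4} {θ : C4 → (C4 →L[ℂ] ℂ)} {p : C4} (hΦ : AnalyticAt ℂ Φ p)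
    (hθ : DifferentiableAt ℂ θ (Φ p)) (u v : C4) :
    extD (fun q => (θ (Φ q)).comp (fderiv ℂ Φ q)) p u v =
      extD θ (Φ p) (fderiv ℂ Φ p u) (fderiv ℂ Φ p v) := by
  have h1 := (hθ.hasFDerivAt.comp p hΦ.differentiableAt.hasFDerivAt).clm_comp
    hΦ.fderiv.differentiableAt.hasFDerivAt
  have hsymm : IsSymmSndFDerivAt ℂ Φ p :=
    (hΦ.contDiffAt (n := ω)).isSymmSndFDerivAt (by simp)
  have h2 : fderiv ℂ (fun q => (θ (Φ q)).comp (fderiv ℂ Φ q)) p = _ := h1.fderiv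
  rw [extD, extD, h2]
  simp [hsymm u v]

lemma wedgeExtD_pullback {Φ : C4 → C4} {θ : C4 → (C4 →L[ℂ] ℂ)} {p : C4}
    (hΦ : AnalyticAt ℂ Φ p) (hθ : DifferentiableAt ℂ θ (Φ p)) (u v w : C4) :
    wedgeExtD (fun q => (θ (Φ q)).comp (fderiv ℂ Φ q)) p u v w =
      wedgeExtD θ (Φ p) (fderiv ℂ Φ p u) (fderiv ℂ Φ p v) (fderiv ℂ Φ p w) := by
  simp [wedgeExtD, extD_pullback hΦ hθ]

lemma exists_apply_eq_one {α : C4 →L[ℂ] ℂ} (hα : α ≠ 0) : ∃ c, α c = 1 := by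
  obtain ⟨v, hv⟩ : ∃ v, α v ≠ 0 := by
    by_contra! h
    exact hα (ContinuousLinearMap.ext h)
  exact ⟨(α v)⁻¹ • v, by simp [hv]⟩

lemma finrank_ker {α : C4 →L[ℂ] ℂ} (hα : α ≠ 0) :
    Module.finrank ℂ (LinearMap.ker α.toLinearMap) = 3 := by
  have h1 := LinearMap.finrank_range_add_finrank_ker α.toLinearMap
  have h2 : LinearMap.range α.toLinearMap = ⊤ :=
    LinearMap.range_eq_top.2 (LinearMap.surjective fun h => hα (ContinuousLinearMap.coe_injective h))
  rw [h2, finrank_top, Module.finrank_self, Module.finrank_fin_fun] at h1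
  omega

/-- An even contact form `θ` whose differential vanishes on a plane field `Δ ⊆ ker θ` has its
characteristic direction, the kernel of `dθ` on `ker θ`, contained in `Δ`. -/
lemma exists_characteristicField {Δ : C4 → Submodule ℂ C4} {V : Fin 2 → C4 → C4}
    {θ : C4 → (C4 →L[ℂ] ℂ)} {p : C4} (hV : ∀ i, AnalyticAt ℂ (V i) p)
    (hΔ : ∀ᶠ q in 𝓝 p, LinearIndependent ℂ (fun i => V i q) ∧
      Submodule.span ℂ (Set.range fun i => V i q) = Δ q)
    (hθ : AnalyticAt ℂ θ p) (hθp : θ p ≠ 0)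
    (hle : ∀ᶠ q in 𝓝 p, Δ q ≤ LinearMap.ker (θ q).toLinearMap)
    (hd : ∀ᶠ q in 𝓝 p, ∀ u ∈ Δ q, ∀ v ∈ Δ q, extD θ q u v = 0)
    (hw : ∃ u v w, wedgeExtD θ p u v w ≠ 0) :
    ∃ ℓ : C4 → C4, AnalyticAt ℂ ℓ p ∧ ℓ p ≠ 0 ∧ ∀ᶠ q in 𝓝 p, ℓ q ∈ Δ q ∧
      ∀ v, θ q v = 0 → extD θ q (ℓ q) v = 0 := by
  obtain ⟨c, hc⟩ := exists_apply_eq_one hθp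
  have hfinΔ : ∀ q, LinearIndependent ℂ (fun i => V i q) →
      Submodule.span ℂ (Set.range fun i => V i q) = Δ q → Module.finrank ℂ (Δ q) = 2 := by
    intro q h1 h2
    rw [← h2, finrank_span_eq_card h1, Fintype.card_fin]
  -- A vector of `ker θ` at `p` outside `Δ`, extended to a field `U` in `ker θ` near `p`.
  obtain ⟨u₀, hu₀, hu₀Δ⟩ : ∃ u₀, θ p u₀ = 0 ∧ u₀ ∉ Δ p := by
    by_contra! h
    have h1 : LinearMap.ker (θ p).toLinearMap ≤ Δ p := fun v hv => h v hv
    have h2 := Submodule.finrank_mono h1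
    rw [finrank_ker hθp, hfinΔ p hΔ.self_of_nhds.1 hΔ.self_of_nhds.2] at h2
    omega
  let U : C4 → C4 := fun q => u₀ - (θ q u₀ / θ q c) • c
  have hθv (v : C4) : AnalyticAt ℂ (fun q => θ q v) p :=
    (ContinuousLinearMap.apply ℂ ℂ v : (C4 →L[ℂ] ℂ) →L[ℂ] ℂ).comp_analyticAt hθ
  have hU : AnalyticAt ℂ U p :=
    analyticAt_const.sub (((hθv u₀).div (hθv c) (by simp [hc])).smul analyticAt_const)
  have hUp : U p = u₀ := by simp [U, hu₀]
  have hUker : ∀ᶠ q in 𝓝 p, θ q (U q) = 0 := by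
    have : ∀ᶠ q in 𝓝 p, θ q c ≠ 0 := (hθv c).continuousAt.eventually_ne (by simp [hc])
    filter_upwards [this] with q hq
    simp [U, hq]
  have happ {a b : C4 → C4} (ha : AnalyticAt ℂ a p) (hb : AnalyticAt ℂ b p) :
      AnalyticAt ℂ (fun q => extD θ q (a q) (b q)) p :=
    (analyticAt_clm_apply (analyticAt_clm_apply hθ.fderiv ha) hb).sub
      (analyticAt_clm_apply (analyticAt_clm_apply hθ.fderiv hb) ha)
  -- `ℓ` lies in `Δ`, and `dθ(ℓ, U) = 0` by the choice of the coefficients.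
  let ℓ : C4 → C4 := fun q => extD θ q (V 1 q) (U q) • V 0 q - extD θ q (V 0 q) (U q) • V 1 q
  have hℓ : AnalyticAt ℂ ℓ p :=
    ((happ (hV 1) hU).smul (hV 0)).sub ((happ (hV 0) hU).smul (hV 1))
  -- Near `p` the fields `V` and `U` form a frame of `ker θ`.
  have hindep : ∀ᶠ q in 𝓝 p, LinearIndependent ℂ ![U q, V 0 q, V 1 q] := by
    have hcont : ContinuousAt (fun q => ![U q, V 0 q, V 1 q]) p := by
      refine continuousAt_pi.2 fun i => ?_
      fin_cases i
      · exact hU.continuousAt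
      · exact (hV 0).continuousAt
      · exact (hV 1).continuousAt
    refine hcont.eventually (isOpen_setOfPred_linearIndependent.mem_nhds ?_)
    obtain ⟨h1, h2⟩ := hΔ.self_of_nhds
    have h3 : ![V 0 p, V 1 p] = fun i => V i p := by
      ext i; fin_cases i <;> rfl
    refine LinearIndependent.finCons (by rw [h3]; exact h1) ?_
    rw [h3, h2, hUp]
    exact hu₀Δ
  have hspan : ∀ᶠ q in 𝓝 p, ∀ v, θ q v = 0 →
      ∃ a b d : ℂ, v = a • U q + (b • V 0 q + d • V 1 q) := by
    have hne : ∀ᶠ q in 𝓝 p, θ q ≠ 0 := hθ.continuousAt.eventually_ne hθp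
    filter_upwards [hindep, hUker, hΔ, hle, hne] with q h1 h2 h3 h4 h5 v hv
    have hmem (i : Fin 2) : θ q (V i q) = 0 :=
      h4 (h3.2 ▸ Submodule.subset_span ⟨i, rfl⟩)
    have h6 : Submodule.span ℂ (Set.range ![U q, V 0 q, V 1 q])
        = LinearMap.ker (θ q).toLinearMap := by
      refine Submodule.eq_of_le_of_finrank_eq (Submodule.span_le.2 ?_) ?_
      · rintro _ ⟨i, rfl⟩
        fin_cases i
        · exact h2
        · exact hmem 0
        · exact hmem 1
      · rw [finrank_span_eq_card h1, finrank_ker h5, Fintype.card_fin]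
    have h7 : v ∈ Submodule.span ℂ (Set.range ![U q, V 0 q, V 1 q]) := by
      rw [h6]; exact hv
    obtain ⟨c, hc⟩ := (Submodule.mem_span_range_iff_exists_fun ℂ).1 h7
    refine ⟨c 0, c 1, c 2, ?_⟩
    rw [← hc]
    simp [Fin.sum_univ_three, add_assoc]
  have hself (q u : C4) : extD θ q u u = 0 := by simp [extD]
  refine ⟨ℓ, hℓ, ?_, ?_⟩
  · -- Otherwise `dθ` would vanish on `ker θ` at `p`.
    intro h0
    obtain ⟨u, v, w, hw⟩ := hw
    refine hw (wedgeExtD_eq_zero hc (fun a b ha hb => ?_) u v w)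
    have h1 := hΔ.self_of_nhds.1
    have h2 := LinearIndependent.pair_iff.1
      (show LinearIndependent ℂ ![V 0 p, V 1 p] by
        convert h1 using 1; ext i; fin_cases i <;> rfl)
      (extD θ p (V 1 p) (U p)) (-extD θ p (V 0 p) (U p)) (by
        rw [neg_smul, ← sub_eq_add_neg]; exact h0)
    have h3 := h2.1
    have h4 := neg_eq_zero.1 h2.2
    have h5 : extD θ p (V 0 p) (V 1 p) = 0 :=
      hd.self_of_nhds _ (hΔ.self_of_nhds.2 ▸ Submodule.subset_span ⟨0, rfl⟩) _
        (hΔ.self_of_nhds.2 ▸ Submodule.subset_span ⟨1, rfl⟩)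
    obtain ⟨a1, a2, a3, rfl⟩ := hspan.self_of_nhds a ha
    obtain ⟨b1, b2, b3, rfl⟩ := hspan.self_of_nhds b hb
    simp only [extD_add_left, extD_add_right, extD_smul_left, extD_smul_right, hself,
      extD_swap θ p (U p), extD_swap θ p (V 1 p) (V 0 p), h3, h4, h5]
    ring
  · filter_upwards [hspan, hΔ, hd] with q h1 h2 h3
    have hmem (i : Fin 2) : V i q ∈ Δ q := h2.2 ▸ Submodule.subset_span ⟨i, rfl⟩
    have h5 := h3 _ (hmem 0) _ (hmem 1)
    refine ⟨Submodule.sub_mem _ (Submodule.smul_mem _ _ (hmem 0))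
      (Submodule.smul_mem _ _ (hmem 1)), fun v hv => ?_⟩
    obtain ⟨b1, b2, b3, rfl⟩ := h1 v hv
    simp only [ℓ, sub_eq_add_neg, ← neg_smul]
    simp only [extD_add_left, extD_add_right, extD_smul_left, extD_smul_right, hself,
      extD_swap θ q (V 1 q) (V 0 q), h5]
    ring

end Forms

/-! ### Adapted charts -/

section AdaptedCharts

/-- A linear change of coordinates adapted to a covector, a plane in its kernel and a vector of
that plane. -/
lemma exists_adaptedBasis {α : C4 →L[ℂ] ℂ} (hα : α ≠ 0) {P : Submodule ℂ C4}
    (hP : P ≤ LinearMap.ker α.toLinearMap) (hP2 : Module.finrank ℂ P = 2) {ℓ : C4} (hℓ : ℓ ∈ P)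
    (hℓ0 : ℓ ≠ 0) :
    ∃ A : C4 ≃L[ℂ] C4, (∀ v, α (A v) = v 0) ∧ A (Pi.single 2 1) ∈ P ∧
      A (Pi.single 3 1) = ℓ := by
  obtain ⟨c, hc⟩ := exists_apply_eq_one hα
  have hfinK := finrank_ker hα
  obtain ⟨u, hu, huP⟩ : ∃ u, α u = 0 ∧ u ∉ P := by
    by_contra! h
    have h2 := Submodule.finrank_mono (show LinearMap.ker α.toLinearMap ≤ P from fun v hv => h v hv)
    omega
  obtain ⟨w, hw, hwℓ⟩ : ∃ w ∈ P, w ∉ Submodule.span ℂ {ℓ} := by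
    by_contra! h
    have h2 := Submodule.finrank_mono (show P ≤ Submodule.span ℂ {ℓ} from h)
    rw [finrank_span_singleton hℓ0] at h2
    omega
  have hli : LinearIndependent ℂ ![c, u, w, ℓ] := by
    refine LinearIndependent.finCons (LinearIndependent.finCons (LinearIndependent.finCons
      ?_ ?_) ?_) ?_
    · exact LinearIndependent.of_subsingleton (0 : Fin 1) (by simpa using hℓ0)
    · simpa using hwℓ
    · intro h
      refine huP (Submodule.span_le.2 ?_ h)
      rintro _ ⟨i, rfl⟩
      fin_cases i
      · exact hw
      · exact hℓ
    · intro h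
      have h1 : c ∈ LinearMap.ker α.toLinearMap := by
        refine Submodule.span_le.2 ?_ h
        rintro _ ⟨i, rfl⟩
        fin_cases i
        · exact hu
        · exact hP hw
        · exact hP hℓ
      have h2 : α c = 0 := h1
      rw [hc] at h2
      exact one_ne_zero h2
  let b := basisOfLinearIndependentOfCardEqFinrank hli (by simp)
  have hb : ⇑b = ![c, u, w, ℓ] := coe_basisOfLinearIndependentOfCardEqFinrank _ _
  let A : C4 ≃L[ℂ] C4 := b.equivFun.symm.toContinuousLinearEquiv
  have hA (v : C4) : A v = v 0 • c + v 1 • u + v 2 • w + v 3 • ℓ := by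
    have : A v = ∑ i, v i • b i := b.equivFun_symm_apply v
    rw [this, hb]
    simp [Fin.sum_univ_four]
  have hαw : α w = 0 := hP hw
  have hαℓ : α ℓ = 0 := hP hℓ
  refine ⟨A, fun v => ?_, ?_, ?_⟩
  · rw [hA]
    simp [hc, hu, hαw, hαℓ]
  · rw [hA]
    simpa using hw
  · rw [hA]
    simp

variable {X : Type*} [TopologicalSpace X] [ChartedSpace C4 X] [IsManifold 𝓘(ℂ, C4) ω X]

/-- A chart `e` in which `[D, D]` is the kernel of the `1`-form `θ` and the characteristic
direction of `[D, D]` is the last coordinate direction. At the origin `θ = dx`, and `D` is spanned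
by `∂_z` and `∂_w`. -/
structure IsAdaptedChart (e : OpenPartialHomeomorph X C4) (θ : C4 → (C4 →L[ℂ] ℂ))
    (D : Distribution X) : Prop where
  mem_maximalAtlas : e ∈ IsManifold.maximalAtlas 𝓘(ℂ, C4) ω X
  zero_mem : 0 ∈ e.target
  analytic : AnalyticOnNhd ℂ θ e.target
  bracket_eq : ∀ q ∈ e.target, chartPullback e (bracket D) q = LinearMap.ker (θ q).toLinearMap
  single_mem : ∀ q ∈ e.target, Pi.single 3 1 ∈ chartPullback e D q
  extD_single : ∀ q ∈ e.target, ∀ v, θ q v = 0 → extD θ q (Pi.single 3 1) v = 0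
  wedge_ne : ∃ u v w, wedgeExtD θ 0 u v w ≠ 0
  form_zero : θ 0 = ContinuousLinearMap.proj 0
  single_mem_zero : Pi.single 2 1 ∈ chartPullback e D 0

lemma chartPullback_le_bracket (e : OpenPartialHomeomorph X C4) (D : Distribution X) (q : C4) :
    chartPullback e D q ≤ chartPullback e (bracket D) q :=
  Submodule.comap_mono le_sup_left

/-- An adapted chart is obtained by straightening the characteristic field of `[D, D]`. -/
theorem exists_isAdaptedChart {D : Distribution X} (hD : IsEngel D) (x : X) :
    ∃ (e : OpenPartialHomeomorph X C4) (θ : C4 → (C4 →L[ℂ] ℂ)),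
      IsAdaptedChart e θ D ∧ x ∈ e.source ∧ e x = 0 := by
  obtain ⟨e, he, hx, θ, hθ, hθe⟩ := hD.evenContact x
  set p := e x with hpdef
  have hp : p ∈ e.target := e.map_source hx
  have hev : ∀ᶠ q in 𝓝 p, q ∈ e.target := e.open_target.mem_nhds hp
  obtain ⟨V, hV, hVΔ⟩ := exists_chartFrame hD.subbundle he hp
  have hle : ∀ᶠ q in 𝓝 p, chartPullback e D q ≤ LinearMap.ker (θ q).toLinearMap :=
    hev.mono fun q hq => (chartPullback_le_bracket e D q).trans (hθe q hq).2.1.le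
  have hd : ∀ᶠ q in 𝓝 p, ∀ u ∈ chartPullback e D q, ∀ v ∈ chartPullback e D q,
      extD θ q u v = 0 := by
    filter_upwards [hev] with q hq u hu v hv
    exact extD_eq_zero_of_bracket_le hD.subbundle he hq (hθ q hq).differentiableAt
      (Filter.mem_of_superset (e.open_target.mem_nhds hq)
        fun q' hq' => (hθe q' hq').2.1.le) hu hv
  obtain ⟨ℓ, hℓ, hℓ0, hℓΔ⟩ := exists_characteristicField hV hVΔ (hθ p hp) (hθe p hp).1 hle hd
    (hθe p hp).2.2
  have hfin : Module.finrank ℂ (chartPullback e D p) = 2 := by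
    rw [← hVΔ.self_of_nhds.2, finrank_span_eq_card hVΔ.self_of_nhds.1, Fintype.card_fin]
  obtain ⟨A, hA0, hA2, hA3⟩ := exists_adaptedBasis (hθe p hp).1 hle.self_of_nhds hfin
    hℓΔ.self_of_nhds.1 hℓ0
  obtain ⟨Φ, h0, hΦ0, hΦ, hΦs, hΦA, hΦℓ⟩ := exists_flowBox hℓ A 3 hA3 (hev.and hℓΔ)
  have htgt : (e ≫ₕ Φ.symm).target = Φ.source := by
    rw [OpenPartialHomeomorph.trans_target]
    simp only [OpenPartialHomeomorph.symm_target, OpenPartialHomeomorph.symm_symm]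
    exact Set.inter_eq_left.2 fun q hq => (hΦs (Φ.map_source hq)).1
  have hpull (D' : Distribution X) {q : C4} (hq : q ∈ Φ.source) :
      chartPullback (e ≫ₕ Φ.symm) D' q =
        (chartPullback e D' (Φ q)).comap (fderiv ℂ Φ q).toLinearMap := by
    have := chartPullback_trans he hΦ.symm D' (p := q) (by rw [htgt]; exact hq)
    simpa using this
  have hfd0 : fderiv ℂ Φ 0 = (A : C4 →L[ℂ] C4) := hΦA.fderiv
  have hΦe {q : C4} (hq : q ∈ Φ.source) : Φ q ∈ e.target := (hΦs (Φ.map_source hq)).1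
  have hpΦ : p ∈ Φ.target := hΦ0 ▸ Φ.map_source h0
  refine ⟨e ≫ₕ Φ.symm, fun q => (θ (Φ q)).comp (fderiv ℂ Φ q), ⟨trans_mem_maximalAtlas he hΦ.symm,
    ?_, ?_, ?_, ?_, ?_, ?_, ?_, ?_⟩, ?_, ?_⟩
  · rw [htgt]; exact h0
  · rw [htgt]
    intro q hq
    have h1 : AnalyticAt ℂ (fun q => θ (Φ q)) q :=
      AnalyticAt.comp (g := θ) (hθ _ (hΦe hq)) (hΦ.analytic q hq)
    exact ((h1.contDiffAt (n := ω)).clm_comp (hΦ.analytic q hq).fderiv.contDiffAt).analyticAt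
  · rw [htgt]
    intro q hq
    rw [hpull _ hq, (hθe _ (hΦe hq)).2.1]
    rfl
  · rw [htgt]
    intro q hq
    rw [hpull _ hq, Submodule.mem_comap]
    have := (hΦs (Φ.map_source hq)).2.1
    rw [← hΦℓ q hq] at this
    exact this
  · rw [htgt]
    intro q hq v hv
    rw [extD_pullback (hΦ.analytic q hq) (hθ _ (hΦe hq)).differentiableAt, hΦℓ q hq]
    exact (hΦs (Φ.map_source hq)).2.2 _ hv
  · obtain ⟨u, v, w, hw⟩ := (hθe p hp).2.2
    refine ⟨A.symm u, A.symm v, A.symm w, ?_⟩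
    rw [wedgeExtD_pullback (hΦ.analytic 0 h0) (hθ _ (hΦe h0)).differentiableAt, hfd0, hΦ0]
    simpa using hw
  · ext1 v
    rw [hfd0, hΦ0]
    exact hA0 v
  · rw [hpull _ h0, hfd0, hΦ0]
    exact hA2
  · rw [OpenPartialHomeomorph.trans_source]
    exact ⟨hx, hpΦ⟩
  · change Φ.symm p = 0
    rw [← hΦ0]
    exact Φ.left_inv h0

end AdaptedCharts

/-! ### Contact normal form -/

section ContactNormalForm

/-- The projection of `ℂ⁴` onto the hyperplane `w = 0` along `∂_w`. -/
noncomputable def projW : C4 →L[ℂ] C4 :=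
  ContinuousLinearMap.id ℂ C4 -
    (ContinuousLinearMap.proj 3 : C4 →L[ℂ] ℂ).smulRight (Pi.single 3 1 : C4)

lemma projW_apply (q : C4) : projW q = q - q 3 • (Pi.single 3 1 : C4) := rfl

lemma projW_apply_of_ne (q : C4) {i : Fin 4} (hi : i ≠ 3) : projW q i = q i := by
  simp [projW_apply, hi]

lemma projW_single_three : projW (Pi.single 3 1) = 0 := by simp [projW_apply]

lemma projW_single_of_ne {i : Fin 4} (hi : i ≠ 3) :
    projW (Pi.single i 1) = Pi.single i 1 := by
  simp [projW_apply, hi.symm]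

lemma projW_projW (q : C4) : projW (projW q) = projW q := by
  have h : projW q 3 = 0 := by simp [projW_apply]
  rw [projW_apply (projW q), h, zero_smul, sub_zero]

lemma tendsto_projW : Tendsto projW (𝓝 0) (𝓝 0) := by
  simpa using projW.continuous.tendsto 0

/-- A function whose derivative along `∂_w` vanishes near the origin does not depend on `w`. -/
lemma eventually_eq_comp_projW {f : C4 → ℂ} (hf : ∀ᶠ q in 𝓝 0, DifferentiableAt ℂ f q)
    (h : ∀ᶠ q in 𝓝 0, fderiv ℂ f q (Pi.single 3 1) = 0) : ∀ᶠ q in 𝓝 0, f q = f (projW q) := by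
  obtain ⟨δ, hδ, hball⟩ := Metric.eventually_nhds_iff_ball.1 (hf.and h)
  filter_upwards [Metric.ball_mem_nhds _ hδ] with q hq
  -- the segment from `projW q` to `q` stays in the ball
  let γ : ℝ → C4 := fun t => projW q + (t : ℂ) • (q 3 • (Pi.single 3 1 : C4))
  have hγ : ∀ t ∈ Set.Icc (0 : ℝ) 1, γ t ∈ Metric.ball (0 : C4) δ := by
    intro t ht
    rw [mem_ball_zero_iff] at hq ⊢
    refine lt_of_le_of_lt ((pi_norm_le_iff_of_nonneg (norm_nonneg q)).2 fun i => ?_) hq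
    by_cases hi : i = 3
    · subst hi
      have h1 : γ t 3 = t * q 3 := by simp [γ, projW_apply]
      rw [h1, norm_mul, Complex.norm_real, Real.norm_eq_abs, abs_of_nonneg ht.1]
      exact (mul_le_of_le_one_left (norm_nonneg _) ht.2).trans (norm_le_pi_norm q 3)
    · have h1 : γ t i = q i := by simp [γ, projW_apply, hi]
      rw [h1]
      exact norm_le_pi_norm q i
  have hderiv : ∀ t ∈ Set.Icc (0 : ℝ) 1, HasDerivWithinAt (fun t => f (γ t)) 0 (Set.Icc 0 1) t := by
    intro t ht
    obtain ⟨h1, h2⟩ := hball _ (hγ t ht)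
    have h3 : HasDerivAt γ (q 3 • (Pi.single 3 1 : C4)) t := by
      have h4 := ((Complex.ofRealCLM.hasDerivAt (x := t)).smul_const
        (q 3 • (Pi.single 3 1 : C4))).const_add (projW q)
      rw [Complex.ofRealCLM_apply, Complex.ofReal_one, one_smul] at h4
      exact h4
    have h5 := (h1.hasFDerivAt.restrictScalars ℝ).comp_hasDerivAt t h3
    have h6 : (fderiv ℂ f (γ t)).restrictScalars ℝ (q 3 • (Pi.single 3 1 : C4)) = 0 := by
      rw [ContinuousLinearMap.coe_restrictScalars', map_smul, h2, smul_zero]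
    rw [h6] at h5
    exact h5.hasDerivWithinAt
  have h7 := constant_of_has_deriv_right_zero
    (fun t ht => (hderiv t ht).continuousWithinAt)
    (fun t ht => ((hderiv t (Set.Ico_subset_Icc_self ht)).mono_of_mem_nhdsWithin
      (Icc_mem_nhdsGE_of_mem ht)))
    1 (Set.right_mem_Icc.2 zero_le_one)
  have h8 : γ 1 = q := by simp [γ, projW_apply]
  have h9 : γ 0 = projW q := by simp [γ]
  simpa [h8, h9] using h7

lemma fderiv_comp_projW {f : C4 → ℂ} {q : C4} (hf : DifferentiableAt ℂ f (projW q)) (v : C4) :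
    fderiv ℂ (fun q => f (projW q)) q v = fderiv ℂ f (projW q) (projW v) := by
  have h := (hf.hasFDerivAt.comp q projW.hasFDerivAt).fderiv
  exact congrArg (fun L : C4 →L[ℂ] ℂ => L v) h

/-- For `r` independent of `w`, a solution `u` of `u_y = r u_x`, also independent of `w`, with
`du = dx` at the origin. It is a first integral of `∂_y - r ∂_x`. -/
lemma exists_firstIntegral {r : C4 → ℂ} (hr : AnalyticAt ℂ r 0) (hr0 : r 0 = 0)
    (hrW : ∀ᶠ q in 𝓝 0, r q = r (projW q)) :
    ∃ u : C4 → ℂ, AnalyticAt ℂ u 0 ∧ (∀ q, u q = u (projW q)) ∧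
      fderiv ℂ u 0 = ContinuousLinearMap.proj 0 ∧
      ∀ᶠ q in 𝓝 0, fderiv ℂ u q (Pi.single 1 1) = r q * fderiv ℂ u q (Pi.single 0 1) := by
  let Y : C4 → C4 := fun q => Pi.single 1 1 - r q • Pi.single 0 1
  have hY : AnalyticAt ℂ Y 0 := analyticAt_const.sub (hr.smul analyticAt_const)
  obtain ⟨Φ, h0, hΦ0, hΦ, -, hΦA, hΦY⟩ := exists_flowBox hY (ContinuousLinearEquiv.refl ℂ C4) 1
    (by simp [Y, hr0]) Filter.univ_mem
  have h0t : (0 : C4) ∈ Φ.target := by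
    have := Φ.map_source h0
    rwa [hΦ0] at this
  have hinv0 : Φ.symm 0 = 0 := by
    have := Φ.left_inv h0
    rwa [hΦ0] at this
  -- the first coordinate of a flow box of `Y`, restricted to `w = 0` to make it independent of `w`
  let u₀ : C4 → ℂ := fun q => Φ.symm q 0
  have hu₀ : ∀ q ∈ Φ.target, AnalyticAt ℂ u₀ q := fun q hq =>
    (ContinuousLinearMap.proj 0 : C4 →L[ℂ] ℂ).comp_analyticAt (hΦ.analytic_symm q hq)
  have hu₀d (q : C4) (hq : q ∈ Φ.target) (v : C4) :
      fderiv ℂ u₀ q (fderiv ℂ Φ (Φ.symm q) v) = v 0 := by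
    have h1 : HasFDerivAt Φ (fderiv ℂ Φ (Φ.symm q)) (Φ.symm q) :=
      (hΦ.analytic _ (Φ.map_target hq)).differentiableAt.hasFDerivAt
    have h2 : HasFDerivAt u₀ (fderiv ℂ u₀ q) (Φ (Φ.symm q)) := by
      rw [Φ.right_inv hq]
      exact (hu₀ q hq).differentiableAt.hasFDerivAt
    have h3 : HasFDerivAt (u₀ ∘ Φ) (ContinuousLinearMap.proj 0 : C4 →L[ℂ] ℂ) (Φ.symm q) := by
      refine (ContinuousLinearMap.proj 0 : C4 →L[ℂ] ℂ).hasFDerivAt.congr_of_eventuallyEq ?_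
      filter_upwards [Φ.open_source.mem_nhds (Φ.map_target hq)] with z hz
      simp [u₀, Φ.left_inv hz]
    exact congrArg (fun L : C4 →L[ℂ] ℂ => L v) ((h2.comp _ h1).unique h3)
  have htgt : ∀ᶠ q in 𝓝 (0 : C4), projW q ∈ Φ.target :=
    tendsto_projW.eventually (Φ.open_target.mem_nhds h0t)
  have hfd : ∀ᶠ q in 𝓝 (0 : C4), ∀ v, fderiv ℂ (fun q => u₀ (projW q)) q v
      = fderiv ℂ u₀ (projW q) (projW v) :=
    htgt.mono fun q hq v => fderiv_comp_projW (hu₀ _ hq).differentiableAt v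
  refine ⟨fun q => u₀ (projW q), ?_, fun q => by simp only [projW_projW], ?_, ?_⟩
  · refine AnalyticAt.comp (g := u₀) (hu₀ _ htgt.self_of_nhds) (projW.analyticAt 0)
  · ext1 v
    rw [hfd.self_of_nhds, map_zero]
    have h1 := hu₀d 0 h0t (projW v)
    rw [hinv0, hΦA.fderiv] at h1
    have h2 : fderiv ℂ u₀ 0 (projW v) = projW v 0 := h1
    rw [h2, projW_apply_of_ne v (by decide)]
    rfl
  · filter_upwards [hfd, htgt, hrW] with q hq hqt hqr
    rw [hq, hq, projW_single_of_ne (by decide), projW_single_of_ne (by decide)]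
    have h1 := hu₀d _ hqt (Pi.single 1 1)
    rw [hΦY _ (Φ.map_target hqt), Φ.right_inv hqt] at h1
    simp only [Y, map_sub, map_smul, smul_eq_mul] at h1
    rw [← hqr] at h1
    have h2 : (Pi.single 1 1 : C4) 0 = 0 := by simp
    rw [h2] at h1
    linear_combination h1

/-- Contact normal form: a `1`-form `θ` with `θ = dx` at the origin, which annihilates `∂_w` and
whose kernel is preserved by the flow of `∂_w`, is proportional to `du - y dz` with `u`, `y`
independent of `w`. -/
lemma exists_contactNormalForm {θ : C4 → (C4 →L[ℂ] ℂ)} (hθ : AnalyticAt ℂ θ 0)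
    (hθ0 : θ 0 = ContinuousLinearMap.proj 0)
    (hθW : ∀ᶠ q in 𝓝 0, θ q (Pi.single 3 1) = 0)
    (hd : ∀ᶠ q in 𝓝 0, ∀ v, θ q v = 0 → extD θ q (Pi.single 3 1) v = 0) :
    ∃ u y f : C4 → ℂ, AnalyticAt ℂ u 0 ∧ AnalyticAt ℂ y 0 ∧ AnalyticAt ℂ f 0 ∧ f 0 = 1 ∧
      fderiv ℂ u 0 = ContinuousLinearMap.proj 0 ∧ y 0 = 0 ∧
      (∀ᶠ q in 𝓝 0, fderiv ℂ u q (Pi.single 3 1) = 0 ∧ fderiv ℂ y q (Pi.single 3 1) = 0) ∧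
      ∀ᶠ q in 𝓝 0, θ q =
        f q • (fderiv ℂ u q - y q • (ContinuousLinearMap.proj 2 : C4 →L[ℂ] ℂ)) := by
  -- the coefficients of `θ`, and their quotients by the coefficient of `dx`
  let a : Fin 4 → C4 → ℂ := fun i q => θ q (Pi.single i 1)
  have ha (i : Fin 4) : AnalyticAt ℂ (a i) 0 := analyticAt_clm_apply hθ analyticAt_const
  have ha0 : a 0 0 = 1 := by simp [a, hθ0]
  have hne : ∀ᶠ q in 𝓝 0, a 0 q ≠ 0 := (ha 0).continuousAt.eventually_ne (by simp [ha0])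
  let r : Fin 4 → C4 → ℂ := fun i q => a i q / a 0 q
  have hr (i : Fin 4) : AnalyticAt ℂ (r i) 0 := (ha i).div (ha 0) (by simp [ha0])
  have hr0 (i : Fin 4) (hi : i ≠ 0) : r i 0 = 0 := by simp [r, a, hθ0, hi.symm]
  -- the quotients do not depend on `w`
  have hrW (i : Fin 4) : ∀ᶠ q in 𝓝 0, r i q = r i (projW q) := by
    refine eventually_eq_comp_projW
      ((hr i).eventually_analyticAt.mono fun q h => h.differentiableAt) ?_
    filter_upwards [hd, hne, hθ.eventually_analyticAt, eventually_eventually_nhds.2 hθW,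
      (hr i).eventually_analyticAt, eventually_eventually_nhds.2 hne] with q h1 h2 h3 h4 hri hneq
    have hda (j : Fin 4) : HasFDerivAt (a j)
        ((ContinuousLinearMap.apply ℂ ℂ (Pi.single j 1 : C4)).comp (fderiv ℂ θ q)) q :=
      (ContinuousLinearMap.apply ℂ ℂ (Pi.single j 1 : C4)).hasFDerivAt.comp q
        h3.differentiableAt.hasFDerivAt
    have h5 (v : C4) : fderiv ℂ θ q v (Pi.single 3 1) = 0 := by
      have h6 : HasFDerivAt (a 3) (0 : C4 →L[ℂ] ℂ) q :=
        (hasFDerivAt_const (0 : ℂ) q).congr_of_eventuallyEq h4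
      exact congrArg (fun L : C4 →L[ℂ] ℂ => L v) ((hda 3).unique h6)
    -- `dθ(∂_w, ·)` vanishes on `a₀ ∂ᵢ - aᵢ ∂₀ ∈ ker θ`
    have h7 := h1 (a 0 q • Pi.single i 1 - a i q • Pi.single 0 1) (by simp [a, mul_comm])
    rw [extD, h5, sub_zero, map_sub, map_smul, map_smul] at h7
    have h8 : HasFDerivAt (a i) (r i q • ((ContinuousLinearMap.apply ℂ ℂ
        (Pi.single 0 1 : C4)).comp (fderiv ℂ θ q)) + a 0 q • fderiv ℂ (r i) q) q := by
      refine (hri.differentiableAt.hasFDerivAt.mul (hda 0)).congr_of_eventuallyEq ?_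
      filter_upwards [hneq] with z hz
      exact (div_mul_cancel₀ _ hz).symm
    have h9 := congrArg (fun L : C4 →L[ℂ] ℂ => L (Pi.single 3 1)) ((hda i).unique h8)
    simp only [smul_apply, add_apply,
      ContinuousLinearMap.comp_apply, ContinuousLinearMap.apply_apply, smul_eq_mul] at h7 h9
    have h10 : a i q = r i q * a 0 q := (div_mul_cancel₀ _ h2).symm
    rw [h10] at h7
    have h11 : a 0 q * a 0 q * fderiv ℂ (r i) q (Pi.single 3 1) = 0 := by
      linear_combination h7 - a 0 q * h9
    exact (mul_eq_zero.1 h11).resolve_left (mul_ne_zero h2 h2)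
  obtain ⟨u, hu, huW, hu0, huY⟩ := exists_firstIntegral (hr 1) (hr0 1 (by decide)) (hrW 1)
  -- `y = (∂_z - r₂ ∂_x) u` is forced by evaluating `du - y dz` on `∂_z - r₂ ∂_x ∈ ker θ`
  let y₀ : C4 → ℂ := fun q => fderiv ℂ u q (Pi.single 2 1) - r 2 q * fderiv ℂ u q (Pi.single 0 1)
  have hdu (v : C4) : AnalyticAt ℂ (fun q => fderiv ℂ u q v) 0 :=
    analyticAt_clm_apply hu.fderiv analyticAt_const
  have hy₀ : AnalyticAt ℂ y₀ 0 := (hdu _).sub ((hr 2).mul (hdu _))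
  have huev : ∀ᶠ q in 𝓝 0, AnalyticAt ℂ u (projW q) :=
    tendsto_projW.eventually hu.eventually_analyticAt
  have hufd : ∀ᶠ q in 𝓝 0, ∀ v, fderiv ℂ u q v = fderiv ℂ u (projW q) (projW v) := by
    filter_upwards [huev] with q hq v
    rw [← fderiv_comp_projW hq.differentiableAt]
    congr 2
    exact funext huW
  have hy₀' : AnalyticAt ℂ y₀ (projW 0) := by rw [map_zero]; exact hy₀
  have hux0 : fderiv ℂ u 0 (Pi.single 0 1) = 1 := by simp [hu0]
  have hux : ∀ᶠ q in 𝓝 0, fderiv ℂ u q (Pi.single 0 1) ≠ 0 :=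
    (hdu _).continuousAt.eventually_ne (by simp [hux0])
  refine ⟨u, fun q => y₀ (projW q), fun q => a 0 q / fderiv ℂ u q (Pi.single 0 1), hu,
    AnalyticAt.comp (g := y₀) hy₀' (projW.analyticAt 0), (ha 0).div (hdu _) (by simp [hux0]),
    by simp only [ha0, hux0, div_one], hu0, ?_, ?_, ?_⟩
  · simp [y₀, hu0, hr0]
  · filter_upwards [hufd, tendsto_projW.eventually hy₀.eventually_analyticAt] with q h1 h2
    rw [h1, fderiv_comp_projW h2.differentiableAt, projW_single_three]
    simp
  · filter_upwards [hne, hux, hufd, huY, hrW 2, hθW] with q h1 h2 h3 h4 h5 h6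
    have hy : y₀ (projW q) = y₀ q := by
      simp only [y₀]
      rw [h3 (Pi.single 2 1), h3 (Pi.single 0 1), projW_single_of_ne (by decide),
        projW_single_of_ne (by decide), ← h5]
    have h7 : fderiv ℂ u q (Pi.single 3 1) = 0 := by rw [h3, projW_single_three, map_zero]
    refine ContinuousLinearMap.coe_injective (LinearMap.pi_ext' fun i => LinearMap.ext_ring ?_)
    have hgoal : a i q = a 0 q / fderiv ℂ u q (Pi.single 0 1) *
        (fderiv ℂ u q (Pi.single i 1) - y₀ (projW q) * (Pi.single i 1 : C4) 2) := by
      rw [hy]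
      fin_cases i
      · simp [h2]
      · simp only [Fin.mk_one, Fin.isValue, h4, r]
        simp
        field_simp
      · simp [y₀, r]
        field_simp
      · simp [h7, a, h6]
    simpa [a] using hgoal

end ContactNormalForm

/-! ### Engel normal forms -/

section NormalForm

lemma mem_standardModel {p v : C4} :
    v ∈ standardModel p ↔ v 0 - p 1 * v 2 = 0 ∧ v 1 - p 3 * v 2 = 0 := by
  simp [standardModel, dc]

lemma mem_variantModel {p v : C4} :
    v ∈ variantModel p ↔ v 0 - p 1 * v 2 = 0 ∧ v 1 - p 3 * v 0 = 0 := by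
  simp [variantModel, dc]

/-- The frame `∂_w`, `∂_z + y ∂_x + w ∂_y` of the standard model. -/
noncomputable def standardFrame : Fin 2 → C4 → C4 :=
  ![fun _ => Pi.single 3 1, fun p => ![p 1, p 3, 1, 0]]

lemma linearIndependent_standardFrame (p : C4) :
    LinearIndependent ℂ (fun i => standardFrame i p) := by
  rw [Fintype.linearIndependent_iff]
  intro g hg
  have h2 := congrFun hg 2
  have h3 := congrFun hg 3
  simp [standardFrame, Fin.sum_univ_two] at h2 h3
  intro i
  fin_cases i
  · exact h3
  · exact h2

lemma span_standardFrame (p : C4) :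
    Submodule.span ℂ (Set.range fun i => standardFrame i p) = standardModel p := by
  refine le_antisymm (Submodule.span_le.2 ?_) fun v hv => ?_
  · rintro _ ⟨i, rfl⟩
    fin_cases i <;> simp [mem_standardModel, standardFrame]
  · rw [mem_standardModel] at hv
    rw [Submodule.mem_span_range_iff_exists_fun]
    refine ⟨![v 3, v 2], ?_⟩
    ext i
    fin_cases i
    · simp [standardFrame, Fin.sum_univ_two]
      linear_combination -hv.1
    · simp [standardFrame, Fin.sum_univ_two]
      linear_combination -hv.2
    · simp [standardFrame, Fin.sum_univ_two]
    · simp [standardFrame, Fin.sum_univ_two]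

lemma finrank_standardModel (p : C4) : Module.finrank ℂ (standardModel p) = 2 := by
  rw [← span_standardFrame, finrank_span_eq_card (linearIndependent_standardFrame p),
    Fintype.card_fin]

variable {X : Type*} [TopologicalSpace X] [ChartedSpace C4 X] [IsManifold 𝓘(ℂ, C4) ω X]

/-- The functions `(u, y, z, w)` which bring `D` into standard form. The first two come from the
contact normal form `du - y dz` of `[D, D]`, and `w = dy / dz` along `D`, which makes
`dy - w dz` vanish on `D`. -/
lemma exists_standardFunctions {D : Distribution X} (hD : IsEngel D)
    {e : OpenPartialHomeomorph X C4} {θ : C4 → (C4 →L[ℂ] ℂ)} (h : IsAdaptedChart e θ D) :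
    ∃ Ψ : C4 → C4, AnalyticAt ℂ Ψ 0 ∧ Function.Injective (fderiv ℂ Ψ 0) ∧
      ∀ᶠ q in 𝓝 0, ∀ v ∈ chartPullback e D q, fderiv ℂ Ψ q v ∈ standardModel (Ψ q) := by
  have hev : ∀ᶠ q in 𝓝 (0 : C4), q ∈ e.target := e.open_target.mem_nhds h.zero_mem
  have hle : ∀ᶠ q in 𝓝 0, chartPullback e D q ≤ LinearMap.ker (θ q).toLinearMap :=
    hev.mono fun q hq => (chartPullback_le_bracket e D q).trans (h.bracket_eq q hq).le
  have hθW : ∀ᶠ q in 𝓝 0, θ q (Pi.single 3 1) = 0 := by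
    filter_upwards [hev, hle] with q h1 h2
    exact h2 (h.single_mem q h1)
  obtain ⟨u, y, f, hu, hy, hf, hf0, hu0, hy0, huy, hθ⟩ := exists_contactNormalForm
    (h.analytic 0 h.zero_mem) h.form_zero hθW (hev.mono fun q hq => h.extD_single q hq)
  let dz : C4 →L[ℂ] ℂ := ContinuousLinearMap.proj 2
  let β₀ : C4 → (C4 →L[ℂ] ℂ) := fun q => fderiv ℂ u q - y q • dz
  have hβ₀ : DifferentiableAt ℂ β₀ 0 :=
    hu.fderiv.differentiableAt.sub (hy.differentiableAt.smul_const dz)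
  have hθβ : θ =ᶠ[𝓝 0] fun q => f q • β₀ q := hθ
  have hβ₀le : ∀ᶠ q in 𝓝 0, chartPullback e D q ≤ LinearMap.ker (β₀ q).toLinearMap := by
    filter_upwards [hle, hθβ, hf.continuousAt.eventually_ne (show f 0 ≠ 0 by simp [hf0])]
      with q h1 h2 h3 v hv
    have h4 : θ q v = 0 := h1 hv
    rw [h2] at h4
    exact (mul_eq_zero.1 h4).resolve_left h3
  -- the field `∂_z` at the origin extends to a section `W` of `D`
  obtain ⟨V, hV, hVΔ⟩ := exists_chartFrame hD.subbundle h.mem_maximalAtlas h.zero_mem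
  obtain ⟨c, hc⟩ := (Submodule.mem_span_range_iff_exists_fun ℂ).1
    (hVΔ.self_of_nhds.2 ▸ h.single_mem_zero)
  let W : C4 → C4 := fun q => c 0 • V 0 q + c 1 • V 1 q
  have hW : AnalyticAt ℂ W 0 :=
    ((analyticAt_const (v := c 0)).smul (hV 0)).add ((analyticAt_const (v := c 1)).smul (hV 1))
  have hW0 : W 0 = Pi.single 2 1 := by rw [← hc, Fin.sum_univ_two]
  have hWmem : ∀ᶠ q in 𝓝 0, W q ∈ chartPullback e D q := by
    filter_upwards [hVΔ] with q hq
    rw [← hq.2]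
    exact Submodule.add_mem _ (Submodule.smul_mem _ _ (Submodule.subset_span ⟨0, rfl⟩))
      (Submodule.smul_mem _ _ (Submodule.subset_span ⟨1, rfl⟩))
  have hWz : AnalyticAt ℂ (fun q => W q 2) 0 := dz.comp_analyticAt hW
  have hWne : ∀ᶠ q in 𝓝 0, W q 2 ≠ 0 := hWz.continuousAt.eventually_ne (by simp [hW0])
  have hspan : ∀ᶠ q in 𝓝 0, ∀ v ∈ chartPullback e D q,
      ∃ a b : ℂ, v = a • Pi.single 3 1 + b • W q := by
    have hcont : ContinuousAt (fun q => ![Pi.single 3 1, W q]) 0 := by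
      refine continuousAt_pi.2 fun i => ?_
      fin_cases i
      · exact continuousAt_const
      · exact hW.continuousAt
    have hli : LinearIndependent ℂ ![(Pi.single 3 1 : C4), W 0] := by
      rw [LinearIndependent.pair_iff]
      intro s t hst
      rw [hW0] at hst
      have h3 := congrFun hst 3
      have h2 := congrFun hst 2
      simp at h3 h2
      exact ⟨h3, h2⟩
    filter_upwards [hcont.eventually (isOpen_setOfPred_linearIndependent.mem_nhds hli), hVΔ, hWmem,
      hev] with q h1 h2 h3 h4 v hv
    have h5 : Submodule.span ℂ (Set.range ![Pi.single 3 1, W q]) = chartPullback e D q := by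
      refine Submodule.eq_of_le_of_finrank_eq (Submodule.span_le.2 ?_) ?_
      · rintro _ ⟨i, rfl⟩
        fin_cases i
        · exact h.single_mem q h4
        · exact h3
      · rw [finrank_span_eq_card h1, ← h2.2, finrank_span_eq_card h2.1]
    rw [← h5, Submodule.mem_span_range_iff_exists_fun] at hv
    obtain ⟨c, rfl⟩ := hv
    exact ⟨c 0, c 1, by simp [Fin.sum_univ_two]⟩
  let w : C4 → ℂ := fun q => fderiv ℂ y q (W q) / W q 2
  have hw : AnalyticAt ℂ w 0 := (analyticAt_clm_apply hy.fderiv hW).div hWz (by simp [hW0])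
  let β : C4 → (C4 →L[ℂ] ℂ) := fun q => fderiv ℂ y q - w q • dz
  have hβ : DifferentiableAt ℂ β 0 :=
    hy.fderiv.differentiableAt.sub (hw.differentiableAt.smul_const dz)
  have hβle : ∀ᶠ q in 𝓝 0, chartPullback e D q ≤ LinearMap.ker (β q).toLinearMap := by
    filter_upwards [hspan, huy, hWne] with q h1 h2 h3 v hv
    obtain ⟨a, b, rfl⟩ := h1 v hv
    have h4 : β q (W q) = 0 := by
      simp [β, w, dz, h3]
    have h5 : β q (Pi.single 3 1) = 0 := by
      simp [β, dz, h2.2]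
    change β q (a • Pi.single 3 1 + b • W q) = 0
    rw [map_add, map_smul, map_smul, h4, h5, smul_zero, smul_zero, add_zero]
  let Ψ : C4 → C4 := fun q => ![u q, y q, q 2, w q]
  have hΨd : ∀ᶠ q in 𝓝 0, ∀ v, fderiv ℂ Ψ q v =
      ![fderiv ℂ u q v, fderiv ℂ y q v, v 2, fderiv ℂ w q v] := by
    filter_upwards [hu.eventually_analyticAt, hy.eventually_analyticAt, hw.eventually_analyticAt]
      with q h1 h2 h3 v
    have h4 : HasFDerivAt Ψ (ContinuousLinearMap.pi
        ![fderiv ℂ u q, fderiv ℂ y q, dz, fderiv ℂ w q]) q := by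
      refine hasFDerivAt_pi.2 fun i => ?_
      fin_cases i
      · exact h1.differentiableAt.hasFDerivAt
      · exact h2.differentiableAt.hasFDerivAt
      · exact dz.hasFDerivAt
      · exact h3.differentiableAt.hasFDerivAt
    rw [h4.fderiv]
    ext i
    fin_cases i <;> rfl
  have hΨ : AnalyticAt ℂ Ψ 0 := by
    refine analyticAt_pi_iff.2 fun i => ?_
    fin_cases i
    · exact hu
    · exact hy
    · exact dz.analyticAt 0
    · exact hw
  have hu3 : fderiv ℂ u 0 (Pi.single 3 1) = 0 := huy.self_of_nhds.1
  have hy3 : fderiv ℂ y 0 (Pi.single 3 1) = 0 := huy.self_of_nhds.2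
  have hβ₀0 (v : C4) : β₀ 0 v = v 0 := by simp [β₀, hu0, hy0]
  -- if the derivative of `y` along the second coordinate vanished, `dθ` would vanish on
  -- `ker θ`, against `θ ∧ dθ ≠ 0`
  have hy1 : fderiv ℂ y 0 (Pi.single 1 1) ≠ 0 := by
    intro h0
    obtain ⟨v₁, v₂, v₃, hv⟩ := h.wedge_ne
    refine hv (wedgeExtD_eq_zero (c := Pi.single 0 1) (by simp [h.form_zero]) ?_ v₁ v₂ v₃)
    intro a b ha hb
    have ha0 : a 0 = 0 := by simpa [h.form_zero] using ha
    have hb0 : b 0 = 0 := by simpa [h.form_zero] using hb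
    have hdy (v : C4) (hv : v 0 = 0) : fderiv ℂ y 0 v = v 2 * fderiv ℂ y 0 (Pi.single 2 1) := by
      have h1 : v = v 1 • Pi.single 1 1 + v 2 • Pi.single 2 1 + v 3 • Pi.single 3 1 := by
        ext i; fin_cases i <;> simp [hv]
      conv_lhs => rw [h1]
      rw [map_add, map_add, map_smul, map_smul, map_smul, h0, hy3]
      simp
    rw [extD_congr hθβ, extD_smul_of_ker hf.differentiableAt hβ₀ (by rw [hβ₀0, ha0])
      (by rw [hβ₀0, hb0]), extD_contactForm hu hy, hdy a ha0, hdy b hb0]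
    ring
  -- if `dw` vanished on the last coordinate direction, then `dβ` would vanish on `D`, so that
  -- `[D, D] ⊆ ker β`, although the second coordinate direction lies in `[D, D]` and not in `ker β`
  have hw3 : fderiv ℂ w 0 (Pi.single 3 1) ≠ 0 := by
    intro h0
    have hle' := chartPullback_bracket_le h.mem_maximalAtlas h.zero_mem hβ hβle (by
      intro a ha b hb
      obtain ⟨a₁, a₂, rfl⟩ := hspan.self_of_nhds a ha
      obtain ⟨b₁, b₂, rfl⟩ := hspan.self_of_nhds b hb
      rw [extD_contactForm hy hw, hW0]
      simp only [map_add, map_smul, h0]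
      simp
      ring)
    rw [h.bracket_eq 0 h.zero_mem] at hle'
    have h1 : β 0 (Pi.single 1 1) = 0 :=
      hle' (by simp [h.form_zero] : Pi.single 1 1 ∈ LinearMap.ker (θ 0).toLinearMap)
    refine hy1 ?_
    simpa [β, dz] using h1
  refine ⟨Ψ, hΨ, ?_, ?_⟩
  · rw [injective_iff_map_eq_zero]
    intro v hv
    rw [hΨd.self_of_nhds] at hv
    have h0 : v 0 = 0 := by simpa [hu0] using congrFun hv 0
    have h2 : v 2 = 0 := by simpa using congrFun hv 2
    have e1 : fderiv ℂ y 0 v = 0 := congrFun hv 1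
    have e3 : fderiv ℂ w 0 v = 0 := congrFun hv 3
    have hv' : v = v 1 • Pi.single 1 1 + v 3 • Pi.single 3 1 := by
      ext i; fin_cases i <;> simp [h0, h2]
    rw [hv', map_add, map_smul, map_smul, hy3, smul_zero, add_zero] at e1
    have h1 : v 1 = 0 := (mul_eq_zero.1 e1).resolve_right hy1
    rw [hv', h1, zero_smul, zero_add, map_smul] at e3
    have h3 : v 3 = 0 := (mul_eq_zero.1 e3).resolve_right hw3
    rw [hv', h1, h3]
    simp
  · filter_upwards [hΨd, hβ₀le, hβle] with q h1 h2 h3 v hv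
    rw [mem_standardModel, h1]
    exact ⟨h2 hv, h3 hv⟩

lemma exists_equiv_of_injective {L : C4 →L[ℂ] C4} (hL : Function.Injective L) :
    ∃ A : C4 ≃L[ℂ] C4, (A : C4 →L[ℂ] C4) = L := by
  refine ⟨(LinearEquiv.ofInjectiveEndo L.toLinearMap hL).toContinuousLinearEquiv, ?_⟩
  ext1 v
  rfl

lemma fderiv_fderiv_symm {Ψ : OpenPartialHomeomorph C4 C4} (hΨ : IsBianalytic Ψ) {p : C4}
    (hp : p ∈ Ψ.target) (v : C4) :
    fderiv ℂ Ψ (Ψ.symm p) (fderiv ℂ Ψ.symm p v) = v := by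
  have h1 := (hΨ.analytic _ (Ψ.map_target hp)).differentiableAt.hasFDerivAt.comp p
    (hΨ.analytic_symm p hp).differentiableAt.hasFDerivAt
  have h2 : HasFDerivAt (Ψ ∘ Ψ.symm) (ContinuousLinearMap.id ℂ C4) p := by
    refine (hasFDerivAt_id p).congr_of_eventuallyEq ?_
    filter_upwards [Ψ.open_target.mem_nhds hp] with z hz
    exact Ψ.right_inv hz
  exact congrArg (fun L : C4 →L[ℂ] C4 => L v) (h1.unique h2)

lemma fderiv_symm_fderiv {Ψ : OpenPartialHomeomorph C4 C4} (hΨ : IsBianalytic Ψ) {p : C4}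
    (hp : p ∈ Ψ.target) (v : C4) :
    fderiv ℂ Ψ.symm p (fderiv ℂ Ψ (Ψ.symm p) v) = v := by
  have := fderiv_fderiv_symm hΨ.symm (p := Ψ.symm p) (Ψ.map_target hp) v
  rwa [Ψ.symm_symm, Ψ.right_inv hp] at this

/-- Both plane fields have rank `2`, so it suffices that `D` is mapped into the standard model. -/
theorem exists_standardChart {D : Distribution X} (hD : IsEngel D) (x : X) :
    ∃ e ∈ IsManifold.maximalAtlas 𝓘(ℂ, C4) ω X, x ∈ e.source ∧
      ∀ p ∈ e.target, chartPullback e D p = standardModel p := by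
  obtain ⟨e, θ, h, hx, hex⟩ := exists_isAdaptedChart hD x
  obtain ⟨F, hF, hFinj, hFD⟩ := exists_standardFunctions hD h
  obtain ⟨A, hA⟩ := exists_equiv_of_injective hFinj
  obtain ⟨V, -, hVΔ⟩ := exists_chartFrame hD.subbundle h.mem_maximalAtlas h.zero_mem
  obtain ⟨Ψ, h0, hΨF, hΨs, hΨ⟩ := exists_isBianalytic hF A
    (by rw [hA]; exact hF.differentiableAt.hasFDerivAt) (hFD.and hVΔ)
  refine ⟨e ≫ₕ Ψ, trans_mem_maximalAtlas h.mem_maximalAtlas hΨ, ?_, fun p hp => ?_⟩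
  · rw [OpenPartialHomeomorph.trans_source]
    exact ⟨hx, by rw [Set.mem_preimage, hex]; exact h0⟩
  · rw [chartPullback_trans h.mem_maximalAtlas hΨ D hp]
    have hpt : p ∈ Ψ.target := by
      rw [OpenPartialHomeomorph.trans_target] at hp
      exact hp.1
    obtain ⟨h1, h2⟩ := hΨs (Ψ.map_target hpt)
    have hΨp : Ψ (Ψ.symm p) = p := Ψ.right_inv hpt
    refine Submodule.eq_of_le_of_finrank_eq (fun v hv => ?_) ?_
    · have h3 : fderiv ℂ F (Ψ.symm p) (fderiv ℂ Ψ.symm p v) ∈ standardModel (F (Ψ.symm p)) :=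
        h1 _ hv
      rw [← hΨF, fderiv_fderiv_symm hΨ hpt, hΨp] at h3
      exact h3
    · let L : C4 ≃ₗ[ℂ] C4 := LinearEquiv.ofLinearMap (fderiv ℂ Ψ (Ψ.symm p)).toLinearMap
        (fderiv ℂ Ψ.symm p).toLinearMap (LinearMap.ext (fderiv_fderiv_symm hΨ hpt))
        (LinearMap.ext (fderiv_symm_fderiv hΨ hpt))
      have h3 : Module.finrank ℂ (chartPullback e D (Ψ.symm p)) = 2 := by
        rw [← h2.2, finrank_span_eq_card h2.1, Fintype.card_fin]
      have h4 : (chartPullback e D (Ψ.symm p)).comap (fderiv ℂ Ψ.symm p).toLinearMap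
          = (chartPullback e D (Ψ.symm p)).map L.toLinearMap :=
        (Submodule.map_equiv_eq_comap_symm L _).symm
      rw [h4, LinearEquiv.finrank_map_eq, h3, finrank_standardModel]

/-- Normalising `y` to be `1` at the given point by the symmetry `(x + cz, y + c, z, w)` of the
standard model, and replacing `w` by `w / y`. -/
theorem exists_variantChart {D : Distribution X} (hD : IsEngel D) (x : X) :
    ∃ e ∈ IsManifold.maximalAtlas 𝓘(ℂ, C4) ω X, x ∈ e.source ∧
      ∀ p ∈ e.target, p 1 ≠ 0 ∧ chartPullback e D p = variantModel p := by
  obtain ⟨e, he, hx, hstd⟩ := exists_standardChart hD x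
  set a := e x with ha
  let c : ℂ := 1 - a 1
  let pr : Fin 4 → C4 →L[ℂ] ℂ := fun i => ContinuousLinearMap.proj i
  let F : C4 → C4 := fun q => ![q 0 + c * q 2, q 1 + c, q 2, q 3 / (q 1 + c)]
  have hca : a 1 + c = 1 := by simp [c]
  have hpr (i : Fin 4) (q : C4) : AnalyticAt ℂ (fun q : C4 => q i) q := (pr i).analyticAt q
  have hF : AnalyticAt ℂ F a := by
    refine analyticAt_pi_iff.2 fun i => ?_
    fin_cases i
    · exact (hpr 0 a).add (analyticAt_const.mul (hpr 2 a))
    · exact (hpr 1 a).add analyticAt_const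
    · exact hpr 2 a
    · exact (hpr 3 a).div ((hpr 1 a).add analyticAt_const) (by simp [hca])
  have hFd (q : C4) (hq : q 1 + c ≠ 0) (v : C4) : fderiv ℂ F q v =
      ![v 0 + c * v 2, v 1, v 2, (v 3 * (q 1 + c) - q 3 * v 1) / (q 1 + c) ^ 2] := by
    have hp (i : Fin 4) : HasFDerivAt (fun q : C4 => q i) (pr i) q := (pr i).hasFDerivAt
    have h3 : HasFDerivAt (fun q : C4 => q 3 / (q 1 + c))
        (q 3 • (-((q 1 + c) ^ 2)⁻¹ • pr 1) + (q 1 + c)⁻¹ • pr 3) q := by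
      have h4 : HasFDerivAt (fun q : C4 => (q 1 + c)⁻¹) (-((q 1 + c) ^ 2)⁻¹ • pr 1) q :=
        (hasDerivAt_inv hq).comp_hasFDerivAt q ((hp 1).add_const c)
      exact ((hp 3).mul h4).congr_of_eventuallyEq (.of_forall fun z => div_eq_mul_inv _ _)
    have h4 : HasFDerivAt F (ContinuousLinearMap.pi ![pr 0 + c • pr 2, pr 1, pr 2,
        q 3 • (-((q 1 + c) ^ 2)⁻¹ • pr 1) + (q 1 + c)⁻¹ • pr 3]) q := by
      refine hasFDerivAt_pi.2 fun i => ?_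
      fin_cases i
      · exact (hp 0).add ((hp 2).const_mul c)
      · exact (hp 1).add_const c
      · exact hp 2
      · exact h3
    rw [h4.fderiv]
    ext i
    fin_cases i
    · simp [pr]
    · simp [pr]
    · simp [pr]
    · simp [pr]
      field_simp
      ring
  have hinj : Function.Injective (fderiv ℂ F a) := by
    rw [injective_iff_map_eq_zero]
    intro v hv
    rw [hFd a (by simp [hca])] at hv
    have h0 := congrFun hv 0
    have h1 := congrFun hv 1
    have h2 := congrFun hv 2
    have h3 := congrFun hv 3
    simp [hca] at h0 h1 h2 h3
    simp [h1, h2] at h0 h3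
    ext i
    fin_cases i
    · exact h0
    · exact h1
    · exact h2
    · exact h3
  obtain ⟨A, hA⟩ := exists_equiv_of_injective hinj
  obtain ⟨Ψ, h0, hΨF, hΨs, hΨ⟩ := exists_isBianalytic hF A
    (by rw [hA]; exact hF.differentiableAt.hasFDerivAt)
    (((hpr 1 a).add (analyticAt_const (v := c))).continuousAt.eventually_ne
      (show a 1 + c ≠ 0 by simp [hca]))
  refine ⟨e ≫ₕ Ψ, trans_mem_maximalAtlas he hΨ, ?_, fun p hp => ?_⟩
  · rw [OpenPartialHomeomorph.trans_source]
    exact ⟨hx, h0⟩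
  · have hp' := hp
    rw [OpenPartialHomeomorph.trans_target] at hp'
    obtain ⟨hpt, hpe⟩ := hp'
    set q := Ψ.symm p with hq
    have hq1 : q 1 + c ≠ 0 := hΨs (Ψ.map_target hpt)
    have hpF : p = F q := by rw [← hΨF]; exact (Ψ.right_inv hpt).symm
    have hp1 : p 1 = q 1 + c := by rw [hpF]; rfl
    have hp3 : p 3 = q 3 / (q 1 + c) := by rw [hpF]; rfl
    refine ⟨by rw [hp1]; exact hq1, ?_⟩
    rw [chartPullback_trans he hΨ D hp, hstd _ hpe]
    ext v
    have hv : fderiv ℂ F q (fderiv ℂ Ψ.symm p v) = v := by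
      rw [← hΨF]; exact fderiv_fderiv_symm hΨ hpt v
    rw [Submodule.mem_comap]
    change fderiv ℂ Ψ.symm p v ∈ standardModel q ↔ _
    set v' := fderiv ℂ Ψ.symm p v
    rw [hFd q hq1] at hv
    rw [mem_standardModel, mem_variantModel, ← hv, hp1, hp3]
    simp
    constructor
    · rintro ⟨h1, h2⟩
      refine ⟨by linear_combination h1, ?_⟩
      field_simp
      linear_combination (q 1 + c) * h2 - q 3 * h1
    · rintro ⟨h1, h2⟩
      field_simp at h2
      refine ⟨by linear_combination h1, ?_⟩
      refine (mul_eq_zero.1 (?_ : (q 1 + c) * (v' 1 - q 3 * v' 2) = 0)).resolve_left hq1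
      linear_combination h2 + q 3 * h1

/-- The contact form `dx - y dz`. -/
noncomputable def standardForm (q : C4) : C4 →L[ℂ] ℂ :=
  ContinuousLinearMap.proj 0 - q 1 • (ContinuousLinearMap.proj 2 : C4 →L[ℂ] ℂ)

lemma extD_standardForm (q u v : C4) : extD standardForm q u v = v 1 * u 2 - u 1 * v 2 := by
  let pr : Fin 4 → C4 →L[ℂ] ℂ := fun i => ContinuousLinearMap.proj i
  have h := extD_contactForm (g := pr 0) (h := pr 1) ((pr 0).analyticAt q) ((pr 1).analyticAt q) u v
  have h1 : standardForm = fun q => fderiv ℂ (pr 0) q - pr 1 q • pr 2 := by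
    ext1 q
    rw [(pr 0).fderiv]
    rfl
  rw [h1, h, (pr 1).fderiv]
  rfl

lemma analyticAt_standardForm (q : C4) : AnalyticAt ℂ standardForm q :=
  analyticAt_const.sub (AnalyticAt.smul (F := C4 →L[ℂ] ℂ)
    ((ContinuousLinearMap.proj 1 : C4 →L[ℂ] ℂ).analyticAt q) analyticAt_const)

lemma chartPullback_refl (D : Distribution C4) (p : C4) :
    chartPullback (OpenPartialHomeomorph.refl C4) D p = D p := by
  have h : mfderiv 𝓘(ℂ, C4) 𝓘(ℂ, C4) (OpenPartialHomeomorph.refl C4).symm p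
      = ContinuousLinearMap.id ℂ (TangentSpace 𝓘(ℂ, C4) p) := mfderiv_id
  ext v
  exact iff_of_eq (congrArg (fun L : C4 →L[ℂ] C4 => L v ∈ D p) h)

lemma analyticAt_standardFrame (i : Fin 2) (q : C4) : AnalyticAt ℂ (standardFrame i) q := by
  have hpr (i : Fin 4) : AnalyticAt ℂ (fun q : C4 => q i) q :=
    (ContinuousLinearMap.proj i : C4 →L[ℂ] ℂ).analyticAt q
  fin_cases i
  · exact analyticAt_const
  · refine analyticAt_pi_iff.2 fun j => ?_
    fin_cases j
    · exact hpr 1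
    · exact hpr 3
    · exact analyticAt_const
    · exact analyticAt_const

lemma holomorphicFieldOn_standardFrame (i : Fin 2) :
    HolomorphicFieldOn (X := C4) (standardFrame i) Set.univ := by
  refine contMDiffOn_vectorSpace_iff_contDiffOn.2 ?_
  exact fun q _ => (analyticAt_standardFrame i q).contDiffAt.contDiffWithinAt

lemma isHolomorphicSubbundle_standardModel :
    IsHolomorphicSubbundle (X := C4) 2 standardModel :=
  fun _ => ⟨Set.univ, isOpen_univ, Set.mem_univ _, standardFrame, holomorphicFieldOn_standardFrame,
    fun q _ => ⟨linearIndependent_standardFrame q, span_standardFrame q⟩⟩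

lemma mlieBracket_eq_lieBracket (V W : (x : C4) → TangentSpace 𝓘(ℂ, C4) x) (p : C4) :
    VectorField.mlieBracket 𝓘(ℂ, C4) V W p =
      VectorField.lieBracket ℂ (V : C4 → C4) (W : C4 → C4) p := by
  rw [← VectorField.mlieBracketWithin_univ, VectorField.mlieBracketWithin_eq_lieBracketWithin]
  exact congrFun (VectorField.lieBracketWithin_univ (𝕜 := ℂ) (V := (V : C4 → C4))
    (W := (W : C4 → C4))) p

/-- `[∂_w, ∂_z + y ∂_x + w ∂_y] = ∂_y`. -/
lemma lieBracket_standardFrame (p : C4) :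
    VectorField.lieBracket ℂ (standardFrame 0) (standardFrame 1) p = Pi.single 1 1 := by
  rw [VectorField.lieBracket_eq]
  let pr : Fin 4 → C4 →L[ℂ] ℂ := fun i => ContinuousLinearMap.proj i
  have h0 : HasFDerivAt (standardFrame 0) (0 : C4 →L[ℂ] C4) p := hasFDerivAt_const _ _
  have h1 : HasFDerivAt (standardFrame 1) (ContinuousLinearMap.pi ![pr 1, pr 3, 0, 0]) p := by
    refine hasFDerivAt_pi.2 fun i => ?_
    fin_cases i
    · exact (pr 1).hasFDerivAt
    · exact (pr 3).hasFDerivAt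
    · exact hasFDerivAt_const _ _
    · exact hasFDerivAt_const _ _
  simp only [h0.fderiv, h1.fderiv]
  ext i
  fin_cases i <;> simp [standardFrame, pr]

lemma bracket_standardModel (p : C4) :
    bracket (X := C4) standardModel p = LinearMap.ker (standardForm p).toLinearMap := by
  have hrefl : OpenPartialHomeomorph.refl C4 ∈ IsManifold.maximalAtlas 𝓘(ℂ, C4) ω C4 :=
    StructureGroupoid.id_mem_maximalAtlas _
  have hmem (q v : C4) (hv : v ∈ chartPullback (OpenPartialHomeomorph.refl C4) standardModel q) :
      v 0 - q 1 * v 2 = 0 ∧ v 1 - q 3 * v 2 = 0 :=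
    mem_standardModel.1 ((chartPullback_refl standardModel q).le hv)
  refine le_antisymm ?_ (fun (v : C4) hv => ?_)
  · have h := chartPullback_bracket_le (D := standardModel) hrefl (p := p) (Set.mem_univ p)
      (analyticAt_standardForm p).differentiableAt
      (.of_forall fun q v hv => (hmem q v hv).1) fun u hu v hv => by
        rw [extD_standardForm]
        linear_combination u 2 * (hmem p v hv).2 - v 2 * (hmem p u hu).2
    exact (chartPullback_refl _ p).ge.trans h
  · have hv0 : v 0 - p 1 * v 2 = 0 := hv
    let K : Submodule ℂ C4 := bracket (X := C4) standardModel p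
    have hfr (q : C4) (i : Fin 2) : standardFrame i q ∈ standardModel q :=
      (span_standardFrame q).le (Submodule.subset_span ⟨i, rfl⟩)
    have hsec (i : Fin 2) : IsLocalSection (X := C4) standardModel p (standardFrame i) :=
      ⟨Set.univ, isOpen_univ, Set.mem_univ _, holomorphicFieldOn_standardFrame i,
        fun q _ => hfr q i⟩
    have hdec : v = ![p 1 * v 2, p 3 * v 2, v 2, v 3]
        + (v 1 - p 3 * v 2) • (Pi.single 1 1 : C4) := by
      ext i
      fin_cases i
      · simp; linear_combination hv0
      · simp
      · simp
      · simp
    have hle (u : C4) (hu : u ∈ standardModel p) : u ∈ K := Submodule.mem_sup_left hu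
    have h1 : ![p 1 * v 2, p 3 * v 2, v 2, v 3] ∈ K :=
      hle _ (mem_standardModel.2 (by simp))
    have h2 : (Pi.single 1 1 : C4) ∈ K := by
      have h3 := (mlieBracket_eq_lieBracket (standardFrame 0) (standardFrame 1) p).trans
        (lieBracket_standardFrame p)
      have h5 : VectorField.mlieBracket (M := C4) 𝓘(ℂ, C4) (standardFrame 0) (standardFrame 1) p ∈
          bracket (X := C4) standardModel p :=
        mlieBracket_mem_bracket (hsec 0) (hsec 1)
      exact h3 ▸ h5
    have h4 : v ∈ K := by
      rw [hdec]
      exact K.add_mem h1 (K.smul_mem _ h2)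
    exact h4

theorem isEngel_standardModel : IsEngel (X := C4) standardModel := by
  refine ⟨isHolomorphicSubbundle_standardModel, fun x => ⟨OpenPartialHomeomorph.refl C4,
    StructureGroupoid.id_mem_maximalAtlas _, Set.mem_univ x, standardForm,
    fun q _ => analyticAt_standardForm q, fun p _ => ⟨fun h => ?_, ?_, ?_⟩⟩⟩
  · have h1 := congrArg (fun L : C4 →L[ℂ] ℂ => L (Pi.single 0 1)) h
    simp [standardForm] at h1
  · rw [chartPullback_refl, bracket_standardModel]
  · refine ⟨Pi.single 0 1, Pi.single 1 1, Pi.single 2 1, ?_⟩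
    simp [wedgeExtD, extD_standardForm, standardForm]

end NormalForm

end HolEngel

theorem mainTheorem2 {X : Type*} [TopologicalSpace X] [ChartedSpace HolEngel.C4 X]
    [IsManifold 𝓘(ℂ, HolEngel.C4) ω X]
    (D : HolEngel.Distribution X) (hD : HolEngel.IsEngel D) (x : X) :
    HolEngel.IsEngel (X := HolEngel.C4) HolEngel.standardModel ∧
    (∃ e ∈ IsManifold.maximalAtlas 𝓘(ℂ, HolEngel.C4) ω X, x ∈ e.source ∧
      ∀ p ∈ e.target, HolEngel.chartPullback e D p = HolEngel.standardModel p) ∧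
    (∃ e ∈ IsManifold.maximalAtlas 𝓘(ℂ, HolEngel.C4) ω X, x ∈ e.source ∧
      ∀ p ∈ e.target, p 1 ≠ 0 ∧
        HolEngel.chartPullback e D p = HolEngel.variantModel p) :=
  ⟨HolEngel.isEngel_standardModel, HolEngel.exists_standardChart hD x,
    HolEngel.exists_variantChart hD x⟩
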